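/- Let $n\ge 2$ and let $G_2^*(\mathbb R^{n+3})=\mathrm{SO}_0(2,n+1)/(\mathrm{SO}(2)\times \mathrm{SO}(n+1))$ be the noncompact real two-plane Grassmannian with origin $o$, where $\mathfrak{so}(2,n+1)=\{X\in M_{n+3}(\mathbb R)\mid {}^tX I+IX=0\}$, $I=\mathrm{diag}(-1,-1,1,\dots,1)$. Write $\mathfrak{so}(2,n+1)=\mathfrak k\oplus\mathfrak p$ for the Cartan decomposition ($\mathfrak k$ the skew-symmetric and $\mathfrak p$ the symmetric matrices), $T_o\cong\mathfrak p$, put $c=2\sqrt2$ and let $U=\begin{pmatrix}0&1\\-1&0\end{pmatrix}$, $V=\begin{pmatrix}0&1\\1&0\end{pmatrix}$. Equip the Grassmannian with the $\mathrm{SO}_0(2,n+1)$-invariant Kähler structure $(g,J)$ that is given on $\mathfrak p$ by $g(X,Y)=c^{-2}\operatorname{tr}({}^tXY)$ and $J=\operatorname{ad}(Z)$, where $Z$ has upper left $2\times2$ block $U$ and zeros elsewhere. With $E_{ij}$ the matrix units, and matrices written in blocks of sizes $2,2,n-1$, put $$A_1=\tfrac c2\big((E_{13}+E_{31})-(E_{24}+E_{42})\big),\qquad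 A_2=\tfrac c2\big((E_{13}+E_{31})+(E_{24}+E_{42})\big),$$ $$X_0=\tfrac c2\begin{pmatrix}U&V&0\\V&U&0\\0&0&0\end{pmatrix},\qquad W_0=\tfrac c2\begin{pmatrix}-U&U&0\\-U&U&0\\0&0&0\end{pmatrix},\qquad R(e)=\tfrac c{\sqrt2}\begin{pmatrix}0&0&e\\0&0&e\\{}^te&-{}^te&0\end{pmatrix},$$ and $Z_i=R(e_{1i})$, $Y_i=R(e_{2i})$ for $1\le i\le n-1$, where $e_{ki}$ are the matrix units of $M_{2,n-1}(\mathbb R)$. Let $\mathfrak s=\mathfrak a\oplus\mathfrak n$ with $\mathfrak a=\mathrm{Span}\{A_1,A_2\}$ and $\mathfrak n=\mathrm{Span}\{X_0,Y_i,Z_i,W_0\}$ be the solvable part of the Iwasawa decomposition, with the inner product pulled back from $T_o$ by $X\mapsto\frac{d}{dt}\big|_{t=0}\exp(tX).o$. Let $N=\frac1{\sqrt2}(-A_1-A_2)$, let $\mathfrak s_N=\mathfrak s\ominus\mathbb RN$ be the orthogonal complement of $N$ in $\mathfrak s$, and let $S_N$ be the connected Lie subgroup with Lie algebra $\mathfrak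 s_N$. Then $a\mapsto a.o$ is a homeomorphism from $S_N$ onto the orbit $S_N.o$, and $S_N.o$ is an embedded real hypersurface of $G_2^*(\mathbb R^{n+3})$, of dimension $2n+1$, on which $\nu_{a.o}=a_*\big(\frac{d}{dt}\big|_{t=0}\exp(tN).o\big)$ $(a\in S_N)$ is a smooth unit normal vector field. On $S_N.o$ let $g$ be the induced metric and put $$\xi=-J\nu,\qquad \eta(X)=g(X,\xi),\qquad \varphi X=JX-\eta(X)\nu .$$ Then $(\eta,\xi,\varphi,g)$ is a contact metric structure on $S_N.o$. That is, it is an almost contact metric structure (all four tensor fields are smooth, $\eta(\xi)=1$, $\varphi^2X=-X+\eta(X)\xi$ and $g(\varphi X,\varphi Y)=g(X,Y)-\eta(X)\eta(Y)$), and $\Phi=d\eta$, where $\Phi(X,Y)=g(X,\varphi Y)$ and $2\,d\eta(X,Y)=X(\eta(Y))-Y(\eta(X))-\eta([X,Y])$ for vector fields $X,Y$. -/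

import Mathlib

open scoped Manifold ContDiff Bundle Matrix.Norms.L2Operator

noncomputable section

namespace LieHypersurface

/-- The differential at `x` of a map from a manifold to a normed space. -/
def differential {E : Type*} [NormedAddCommGroup E] [NormedSpace ℝ E]
    {H : Type*} [TopologicalSpace H] (I : ModelWithCorners ℝ E H)
    {M : Type*} [TopologicalSpace M] [ChartedSpace H M]
    {W : Type*} [NormedAddCommGroup W] [NormedSpace ℝ W] (f : M → W) (x : M) :
    TangentSpace I x →L[ℝ] W :=
  mfderiv I 𝓘(ℝ, W) f x

/-! ### Contact metric structures on a smooth manifold -/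

section Contact

variable {E : Type*} [NormedAddCommGroup E] [NormedSpace ℝ E]
  {H : Type*} [TopologicalSpace H] (I : ModelWithCorners ℝ E H)
  (M : Type*) [TopologicalSpace M] [ChartedSpace H M] [IsManifold I ∞ M]

/-- An almost contact metric structure `(η, ξ, φ, g)` on `M`, all tensor fields being smooth. -/
structure AlmostContactMetricStructure where
  /-- the Riemannian metric -/
  g : Bundle.ContMDiffRiemannianMetric I ∞ E (fun x : M => TangentSpace I x)
  /-- the characteristic vector field -/
  ξ : ∀ x : M, TangentSpace I x
  /-- the `1`-form -/
  η : ∀ x : M, TangentSpace I x →L[ℝ] ℝ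
  /-- the `(1,1)`-tensor field -/
  φ : ∀ x : M, TangentSpace I x →L[ℝ] TangentSpace I x
  smooth_ξ : ContMDiff I I.tangent ∞ (fun x => (⟨x, ξ x⟩ : TangentBundle I M))
  smooth_η : ContMDiff I (I.prod 𝓘(ℝ, E →L[ℝ] ℝ)) ∞
    (fun x => Bundle.TotalSpace.mk' (E →L[ℝ] ℝ)
      (E := fun x : M => TangentSpace I x →L[ℝ] Bundle.Trivial M ℝ x) x (η x))
  smooth_φ : ContMDiff I (I.prod 𝓘(ℝ, E →L[ℝ] E)) ∞
    (fun x => Bundle.TotalSpace.mk' (E →L[ℝ] E)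
      (E := fun x : M => TangentSpace I x →L[ℝ] TangentSpace I x) x (φ x))
  η_ξ : ∀ x, η x (ξ x) = 1
  φ_φ : ∀ x (u : TangentSpace I x), φ x (φ x u) = -u + η x u • ξ x
  g_φ_φ : ∀ x (u v : TangentSpace I x),
    g.inner x (φ x u) (φ x v) = g.inner x u v - η x u * η x v

variable {M}

/-- The value at `x` of `dη (X, Y)`, in the normalization
`2 dη(X, Y) = X (η(Y)) - Y (η(X)) - η([X, Y])`. -/
def extDerivOneForm (η : ∀ x : M, TangentSpace I x →L[ℝ] ℝ)
    (X Y : ∀ x : M, TangentSpace I x) (x : M) : ℝ :=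
  (1 / 2) * (differential I (fun y => η y (Y y)) x (X x)
    - differential I (fun y => η y (X y)) x (Y x)
    - η x (VectorField.mlieBracket I X Y x))

variable {I}

/-- The fundamental `2`-form `Φ(u, v) = g(u, φ v)`. -/
def AlmostContactMetricStructure.fundamentalForm (s : AlmostContactMetricStructure I M)
    (x : M) (u v : TangentSpace I x) : ℝ :=
  s.g.inner x u (s.φ x v)

/-- The contact metric condition `Φ = dη`, tested on all vector fields near each point. -/
def AlmostContactMetricStructure.IsContactMetric (s : AlmostContactMetricStructure I M) : Prop :=
  ∀ (x : M) (X Y : ∀ y : M, TangentSpace I y),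
    ContMDiffAt I I.tangent ∞ (fun y => (⟨y, X y⟩ : TangentBundle I M)) x →
    ContMDiffAt I I.tangent ∞ (fun y => (⟨y, Y y⟩ : TangentBundle I M)) x →
    s.fundamentalForm x (X x) (Y x) = extDerivOneForm I s.η X Y x

end Contact

/-! ### The noncompact real two-plane Grassmannian -/

/-- The coordinates of `ℝ^{n+3}`, in blocks of sizes `2, 2, n - 1`. -/
abbrev Idx (n : ℕ) : Type := Fin 2 ⊕ (Fin 2 ⊕ Fin (n - 1))

/-- Real square matrices of size `n + 3`. -/
abbrev Mat (n : ℕ) : Type := Matrix (Idx n) (Idx n) ℝ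

/-- The Lie algebra `𝔰𝔬(2, n + 1)`. -/
def so (n : ℕ) : Submodule ℝ (Mat n) :=
  skewAdjointMatricesSubmodule
    (LieAlgebra.Orthogonal.indefiniteDiagonal (Fin 2) (Fin 2 ⊕ Fin (n - 1)) ℝ)

/-- The subgroup generated by `exp 𝔥`; if `𝔥` is a Lie subalgebra, this is the connected Lie
subgroup with Lie algebra `𝔥`. -/
def connectedLieSubgroup {n : ℕ} (𝔥 : Submodule ℝ (Mat n)) : Subgroup (GL (Idx n) ℝ) :=
  Subgroup.closure {a | ∃ X ∈ 𝔥, (a : Mat n) = NormedSpace.exp X}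

/-- The identity component `SO₀(2, n + 1)`. -/
def SO₀ (n : ℕ) : Subgroup (GL (Idx n) ℝ) :=
  connectedLieSubgroup (so n)

/-- The matrix of rotation by a right angle. -/
def U : Matrix (Fin 2) (Fin 2) ℝ := !![0, 1; -1, 0]

/-- The matrix of the exchange of the two coordinates. -/
def V : Matrix (Fin 2) (Fin 2) ℝ := !![0, 1; 1, 0]

/-- The block matrix with third block row and third block column equal to zero. -/
def block (n : ℕ) (a b c d : Matrix (Fin 2) (Fin 2) ℝ) : Mat n :=
  Matrix.fromBlocks a (Matrix.fromCols b 0) (Matrix.fromRows c 0) (Matrix.fromBlocks d 0 0 0)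

/-- The element `Z` of the center of `𝔨 = 𝔰𝔬(2) ⊕ 𝔰𝔬(n + 1)` that defines the complex structure. -/
def Z (n : ℕ) : Mat n := block n U 0 0 0

/-- The conjugation action of invertible matrices on matrices. -/
def Ad {n : ℕ} (a : GL (Idx n) ℝ) (p : Mat n) : Mat n :=
  (a : Mat n) * p * ((a⁻¹ : GL (Idx n) ℝ) : Mat n)

/-- `G₂*(ℝ^{n+3}) = SO₀(2, n + 1) / (SO(2) × SO(n + 1))`. The denominator is the stabilizer of `Z`
under conjugation, and the quotient is realized as the orbit of `Z`, with `Z` as the origin `o`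
(the point `p` corresponds to the definite `2`-plane that is the image of `p`). -/
def grassmannian (n : ℕ) : Set (Mat n) := {p | ∃ a ∈ SO₀ n, p = Ad a (Z n)}

/-- The velocity at `p` of the curve `t ↦ exp (t X) . p`. For `X ∈ 𝔭` and `p = o` this is the usual
identification of `𝔭` with the tangent space at `o`. -/
def velocity {n : ℕ} (X p : Mat n) : Mat n := X * p - p * X

/-- `u` is tangent to the Grassmannian at its point `p`. -/
def IsTangent {n : ℕ} (p u : Mat n) : Prop := ∃ X ∈ so n, u = velocity X p

/-- The scaling `c = 2 √2`; the minimal sectional curvature is `-c²`. -/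
def c₀ : ℝ := 2 * Real.sqrt 2

/-- The `SO₀(2, n + 1)`-invariant metric of the Grassmannian on tangent vectors (at any point).
At `o` the tangent space is `𝔭`, where the matrices are symmetric, and this is
`c⁻² tr (ᵗu v)`. -/
def metric {n : ℕ} (u v : Mat n) : ℝ := (1 / c₀ ^ 2) * Matrix.trace (u * v)

/-- The `SO₀(2, n + 1)`-invariant complex structure of the Grassmannian at the point `p`, on tangent
vectors. At `o` it is `ad Z` on `𝔭`. -/
def J {n : ℕ} (p u : Mat n) : Mat n := p * u - u * p

/-! ### The solvable model and the group `S_N` -/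

/-- `A₁`. -/
def A₁ (n : ℕ) : Mat n := (c₀ / 2) • block n 0 !![1, 0; 0, -1] !![1, 0; 0, -1] 0

/-- `A₂`. -/
def A₂ (n : ℕ) : Mat n := (c₀ / 2) • block n 0 1 1 0

/-- `X₀`, a root vector. -/
def X₀ (n : ℕ) : Mat n := (c₀ / 2) • block n U V V U

/-- `W₀`, a root vector. -/
def W₀ (n : ℕ) : Mat n := (c₀ / 2) • block n (-U) U (-U) U

/-- The root vectors `Z_i` (`k = 0`) and `Y_i` (`k = 1`). -/
def shortRoot (n : ℕ) (k : Fin 2) (i : Fin (n - 1)) : Mat n :=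
  (c₀ / Real.sqrt 2) •
    Matrix.fromBlocks 0
      (Matrix.fromCols 0 (Matrix.single k i 1))
      (Matrix.fromRows 0 (Matrix.single i k 1))
      (Matrix.fromBlocks 0 (Matrix.single k i 1) (-Matrix.single i k 1) 0)

/-- The solvable part `𝔰 = 𝔞 ⊕ 𝔫` of the Iwasawa decomposition of `𝔰𝔬(2, n + 1)`, with
`𝔞 = Span {A₁, A₂}` and `𝔫 = Span {X₀, Y_i, Z_i, W₀}`. -/
def solvablePart (n : ℕ) : Submodule ℝ (Mat n) :=
  Submodule.span ℝ ({A₁ n, A₂ n, X₀ n, W₀ n} ∪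
    Set.range (shortRoot n 0) ∪ Set.range (shortRoot n 1))

/-- The inner product of the solvable model, induced from the metric at `o` by `X ↦ d/dt exp(tX).o`.
The basis `A₁, A₂, X₀, Y_i, Z_i, W₀` of `𝔰` is orthonormal. -/
def modelInner {n : ℕ} (X Y : Mat n) : ℝ := metric (velocity X (Z n)) (velocity Y (Z n))

/-- The unit vector `N = (1/√2) (-A₁ - A₂) ∈ 𝔞`. -/
def N (n : ℕ) : Mat n := (1 / Real.sqrt 2) • (-A₁ n - A₂ n)

/-- `𝔰_N = 𝔰 ⊖ ℝ N`. -/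
def sN (n : ℕ) : Submodule ℝ (Mat n) where
  carrier := {X | X ∈ solvablePart n ∧ modelInner X (N n) = 0}
  zero_mem' := ⟨Submodule.zero_mem _, by simp [modelInner, metric, velocity]⟩
  add_mem' := by
    rintro X Y ⟨hX, hX'⟩ ⟨hY, hY'⟩
    refine ⟨Submodule.add_mem _ hX hY, ?_⟩
    have h : velocity (X + Y) (Z n) = velocity X (Z n) + velocity Y (Z n) := by
      simp only [velocity, add_mul, mul_add]; abel
    simp only [modelInner, metric] at hX' hY' ⊢
    rw [h, add_mul, Matrix.trace_add, mul_add, hX', hY', add_zero]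
  smul_mem' := by
    rintro r X ⟨hX, hX'⟩
    refine ⟨Submodule.smul_mem _ r hX, ?_⟩
    have h : velocity (r • X) (Z n) = r • velocity X (Z n) := by
      simp only [velocity, smul_mul_assoc, mul_smul_comm, smul_sub]
    simp only [modelInner, metric] at hX' ⊢
    rw [h, smul_mul_assoc, Matrix.trace_smul, smul_eq_mul, mul_left_comm, hX', mul_zero]

/-- The connected Lie group `S_N` with Lie algebra `𝔰_N`. -/
def SN (n : ℕ) : Subgroup (GL (Idx n) ℝ) := connectedLieSubgroup (sN n)

/-- The Lie hypersurface `S_N.o`. -/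
def orbitSN (n : ℕ) : Set (Mat n) := {p | ∃ a ∈ SN n, p = Ad a (Z n)}

/-! ### Real hypersurfaces of the Grassmannian and their induced structures -/

section Hypersurface

variable {n : ℕ} {E : Type*} [NormedAddCommGroup E] [NormedSpace ℝ E]
  {H : Type*} [TopologicalSpace H] (I : ModelWithCorners ℝ E H)
  {M : Type*} [TopologicalSpace M] [ChartedSpace H M]

/-- `f` embeds the manifold `M` as a real hypersurface of the Grassmannian, and `ν` is a smooth
unit normal vector field along `f`. -/
structure IsHypersurfaceWithUnitNormal (f : M → Mat n) (ν : M → Mat n) : Prop where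
  isEmbedding : Topology.IsEmbedding f
  contMDiff : ContMDiff I 𝓘(ℝ, Mat n) ∞ f
  injective_mfderiv : ∀ x, Function.Injective (differential I f x)
  mem : ∀ x, f x ∈ grassmannian n
  contMDiff_normal : ContMDiff I 𝓘(ℝ, Mat n) ∞ ν
  isTangent_normal : ∀ x, IsTangent (f x) (ν x)
  unit : ∀ x, metric (ν x) (ν x) = 1
  normal : ∀ x (u : TangentSpace I x), metric (differential I f x u) (ν x) = 0
  /-- the tangent space of the Grassmannian is the direct sum of that of `M` and of `ℝ ν` -/
  codim_one : ∀ x (w : Mat n), IsTangent (f x) w ↔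
    ∃ (u : TangentSpace I x) (r : ℝ), w = differential I f x u + r • ν x

/-- `s` is the structure that the Grassmannian induces on its hypersurface `f : M → G₂*(ℝ^{n+3})`
with unit normal field `ν`: the metric is induced, `ξ = -J ν`, `η(u) = g(u, ξ)` and
`φ u = J u - η(u) ν`. -/
structure IsInducedStructure [IsManifold I ∞ M] (f : M → Mat n) (ν : M → Mat n)
    (s : AlmostContactMetricStructure I M) : Prop where
  metric_eq : ∀ x (u v : TangentSpace I x), s.g.inner x u v =
    metric (differential I f x u) (differential I f x v)
  ξ_eq : ∀ x, differential I f x (s.ξ x) = -J (f x) (ν x)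
  η_eq : ∀ x (u : TangentSpace I x), s.η x u = s.g.inner x u (s.ξ x)
  φ_eq : ∀ x (u : TangentSpace I x), differential I f x (s.φ x u) =
    J (f x) (differential I f x u) - s.η x u • ν x

end Hypersurface

end LieHypersurface

end

/-!
Write `⟨·, ·⟩` for the form of signature `(2, n + 1)` that is positive on the planes parametrized by
the Grassmannian, and identify an oriented plane with the bivector `x ∧ y` of an oriented
orthonormal basis; the origin is `e₁ ∧ e₂`. The group `S_N` fixes the isotropic vector
`ℓ = e₁ + e₃`, and `⟨e₁, ℓ⟩ = 1`, `⟨e₂, ℓ⟩ = 0`. Hence the frame `f₁ = a e₁`, `f₂ = a e₂`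
at `a.o` satisfies `⟨f₁, ℓ⟩ = 1` and `⟨f₂, ℓ⟩ = 0`, and it is recovered from the point `p = a.o` as
`f₂ = -p ℓ`, `f₁ = -p (p ℓ)`. The pairs `(f₁, f₂)` that occur are the graph of a smooth
map over `ℝ^{2n+1}`, which gives both the embedding of `S_N` and a global chart of the orbit.

The contact condition uses only the two equations for `f₁` and `f₂`. The normal vector moves `f₁` in
the direction `2 (f₁ - ℓ)`, and a computation with `ξ = -J ν` gives `η = -(1 / 2) ⟨f₁, df₂⟩`. Since
`-(1 / 2) (⟨df₁ u, df₂ v⟩ - ⟨df₁ v, df₂ u⟩)` is then `2 dη(u, v)`, and the Kähler form of the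
Grassmannian is half of it, `Φ = dη`.
-/

noncomputable section

namespace LieHypersurface

/-! ### Manifolds with a global chart -/

theorem isVonNBounded_setOf_lt_one {E : Type*} [NormedAddCommGroup E] [NormedSpace ℝ E]
    [FiniteDimensional ℝ E] (B : E →L[ℝ] E →L[ℝ] ℝ) (hB : ∀ v, v ≠ 0 → 0 < B v v) :
    Bornology.IsVonNBounded ℝ {v | B v v < 1} := by
  rw [NormedSpace.isVonNBounded_iff ℝ, isBounded_iff_forall_norm_le]
  obtain hE | hE := subsingleton_or_nontrivial E
  · exact ⟨0, fun v _ => by simp [Subsingleton.elim v 0]⟩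
  have hcont : Continuous fun v : E => B v v := by fun_prop
  obtain ⟨w, hw, hmin⟩ := (isCompact_sphere (0 : E) 1).exists_isMinOn
    (NormedSpace.sphere_nonempty.2 zero_le_one) hcont.continuousOn
  set m := B w w
  have hm : 0 < m := hB w (ne_zero_of_mem_unit_sphere ⟨w, hw⟩)
  have hlow (v : E) : m * ‖v‖ ^ 2 ≤ B v v := by
    obtain rfl | hv := eq_or_ne v 0
    · simp
    have hv' : ‖v‖ ≠ 0 := norm_ne_zero_iff.2 hv
    have hmv : m ≤ B (‖v‖⁻¹ • v) (‖v‖⁻¹ • v) := hmin (by simp [norm_smul, inv_mul_cancel₀ hv'])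
    simp only [map_smul, smul_apply, smul_eq_mul] at hmv
    calc m * ‖v‖ ^ 2 ≤ (‖v‖⁻¹ * (‖v‖⁻¹ * B v v)) * ‖v‖ ^ 2 := by gcongr
      _ = B v v := by field_simp
  refine ⟨m⁻¹ + 1, fun v hv => ?_⟩
  have hsq : ‖v‖ ^ 2 < m⁻¹ := by
    rw [← one_div, lt_div_iff₀ hm, mul_comm]
    exact (hlow v).trans_lt hv
  nlinarith [norm_nonneg v, inv_pos.2 hm]

section GlobalChart

variable {E : Type*} [NormedAddCommGroup E] [NormedSpace ℝ E]
  {M : Type*} [TopologicalSpace M] [ChartedSpace E M] (e : M ≃ₜ E)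

/-- The manifold `M` is described by the single global chart `e`. -/
def IsGlobalChart : Prop :=
  ∀ x : M, chartAt E x = e.toOpenPartialHomeomorph

variable {e} (he : IsGlobalChart e)
include he

theorem IsGlobalChart.extChartAt_coe (x : M) :
    (extChartAt 𝓘(ℝ, E) x : M → E) = e := by
  simp [extChartAt, he x]

theorem IsGlobalChart.extChartAt_symm_coe (x : M) :
    ((extChartAt 𝓘(ℝ, E) x).symm : E → M) = e.symm := by
  simp [extChartAt, he x]

theorem IsGlobalChart.contMDiffAt_iff {W : Type*} [NormedAddCommGroup W] [NormedSpace ℝ W]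
    {f : M → W} {k : WithTop ℕ∞} {x : M} :
    ContMDiffAt 𝓘(ℝ, E) 𝓘(ℝ, W) k f x ↔ ContDiffAt ℝ k (f ∘ e.symm) (e x) := by
  rw [_root_.contMDiffAt_iff]
  simp only [he.extChartAt_coe, he.extChartAt_symm_coe, extChartAt_model_space_eq_id,
    modelWithCornersSelf_coe, Set.range_id, contDiffWithinAt_univ, PartialEquiv.refl_coe,
    Function.id_comp]
  refine ⟨fun h => h.2, fun h => ⟨?_, h⟩⟩
  have := h.continuousAt.comp (f := e) (x := x) e.continuous.continuousAt
  simpa [Function.comp_def] using this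

theorem IsGlobalChart.contMDiff_iff {W : Type*} [NormedAddCommGroup W] [NormedSpace ℝ W]
    {f : M → W} {k : WithTop ℕ∞} :
    ContMDiff 𝓘(ℝ, E) 𝓘(ℝ, W) k f ↔ ContDiff ℝ k (f ∘ e.symm) := by
  rw [contDiff_iff_contDiffAt]
  refine ⟨fun h t => ?_, fun h x => he.contMDiffAt_iff.2 (h _)⟩
  simpa using he.contMDiffAt_iff.1 (h (e.symm t))

theorem IsGlobalChart.differential_eq {W : Type*} [NormedAddCommGroup W] [NormedSpace ℝ W]
    {f : M → W} {x : M} (hf : DifferentiableAt ℝ (f ∘ e.symm) (e x)) :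
    differential 𝓘(ℝ, E) f x = fderiv ℝ (f ∘ e.symm) (e x) := by
  have hd : MDifferentiableAt 𝓘(ℝ, E) 𝓘(ℝ, W) f x := by
    rw [mdifferentiableAt_iff]
    refine ⟨?_, ?_⟩
    · have := hf.continuousAt.comp (f := e) (x := x) e.continuous.continuousAt
      simpa [Function.comp_def] using this
    · simp only [writtenInExtChartAt, he.extChartAt_coe, he.extChartAt_symm_coe,
        extChartAt_model_space_eq_id, modelWithCornersSelf_coe, Set.range_id,
        PartialEquiv.refl_coe, Function.id_comp]
      exact hf.differentiableWithinAt
  rw [differential, hd.mfderiv]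
  simp only [writtenInExtChartAt, he.extChartAt_coe, he.extChartAt_symm_coe,
    extChartAt_model_space_eq_id, modelWithCornersSelf_coe, Set.range_id, fderivWithin_univ,
    PartialEquiv.refl_coe, Function.id_comp]
  rfl

theorem IsGlobalChart.contMDiff_comp {W : Type*} [NormedAddCommGroup W] [NormedSpace ℝ W]
    {F : E → W} {k : WithTop ℕ∞} (hF : ContDiff ℝ k F) : ContMDiff 𝓘(ℝ, E) 𝓘(ℝ, W) k (F ∘ e) :=
  he.contMDiff_iff.2 (by rwa [Function.comp_assoc, e.self_comp_symm, Function.comp_id])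

theorem IsGlobalChart.differential_comp {W : Type*} [NormedAddCommGroup W] [NormedSpace ℝ W]
    {F : E → W} (hF : Differentiable ℝ F) (x : M) :
    differential 𝓘(ℝ, E) (F ∘ e) x = fderiv ℝ F (e x) := by
  have hcomp : (F ∘ e) ∘ e.symm = F := by
    rw [Function.comp_assoc, e.self_comp_symm, Function.comp_id]
  rw [he.differential_eq (by rw [hcomp]; exact hF _), hcomp]

theorem IsGlobalChart.mfderivWithin_symm_eq (t : E) :
    mfderivWithin 𝓘(ℝ, E) 𝓘(ℝ, E) e.symm Set.univ t = ContinuousLinearMap.id ℝ E := by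
  have hd : MDifferentiableWithinAt 𝓘(ℝ, E) 𝓘(ℝ, E) e.symm Set.univ t := by
    rw [mdifferentiableWithinAt_iff]
    refine ⟨e.symm.continuous.continuousWithinAt, ?_⟩
    simp only [he.extChartAt_coe, extChartAt_model_space_eq_id,
      PartialEquiv.refl_coe, PartialEquiv.refl_symm, Function.comp_id]
    simp [Function.comp_def, differentiableWithinAt_fun_id]
  rw [hd.mfderivWithin]
  simp only [writtenInExtChartAt, he.extChartAt_coe, extChartAt_model_space_eq_id,
      PartialEquiv.refl_coe, PartialEquiv.refl_symm, Function.comp_id]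
  simp only [Function.comp_def, Homeomorph.apply_symm_apply, modelWithCornersSelf_coe,
    Set.range_id, Set.preimage_univ, Set.inter_univ, fderivWithin_univ]
  exact fderiv_id

theorem IsGlobalChart.mlieBracket_eq (X Y : ∀ x : M, TangentSpace 𝓘(ℝ, E) x) (x : M) :
    VectorField.mlieBracket 𝓘(ℝ, E) X Y x =
      VectorField.lieBracket ℝ (fun t => (X (e.symm t) : E)) (fun t => (Y (e.symm t) : E))
        (e x) := by
  have hchart : mfderiv 𝓘(ℝ, E) 𝓘(ℝ, E) (extChartAt 𝓘(ℝ, E) x) x = ContinuousLinearMap.id ℝ E := by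
    rw [he.extChartAt_coe]
    refine (he.differential_eq (f := e) ?_).trans ?_
    · simp [Function.comp_def]
    · simp only [Function.comp_def, Homeomorph.apply_symm_apply]
      exact fderiv_id
  have hpull (V : ∀ x : M, TangentSpace 𝓘(ℝ, E) x) : VectorField.mpullbackWithin 𝓘(ℝ, E) 𝓘(ℝ, E)
      (extChartAt 𝓘(ℝ, E) x).symm V (Set.range 𝓘(ℝ, E)) = fun t => (V (e.symm t) : E) := by
    funext t
    rw [he.extChartAt_symm_coe, modelWithCornersSelf_coe, Set.range_id]
    refine (congrArg (fun L : E →L[ℝ] E => L.inverse (V (e.symm t)))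
      (he.mfderivWithin_symm_eq t)).trans ?_
    simp only [ContinuousLinearMap.inverse_id]
    rfl
  rw [← VectorField.mlieBracketWithin_univ, VectorField.mlieBracketWithin_apply, hpull, hpull]
  refine (congrArg (fun L : E →L[ℝ] E => L.inverse _) hchart).trans ?_
  simp only [ContinuousLinearMap.inverse_id, he.extChartAt_coe, modelWithCornersSelf_coe,
    Set.range_id, Set.preimage_univ, Set.inter_univ]
  exact congrFun (VectorField.lieBracketWithin_univ (𝕜 := ℝ) (V := fun t => (X (e.symm t) : E))
    (W := fun t => (Y (e.symm t) : E))) (e x)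

theorem IsGlobalChart.contMDiff_section {F : Type*} [NormedAddCommGroup F] [NormedSpace ℝ F]
    {V : M → Type*} [∀ x, TopologicalSpace (V x)] [∀ x, AddCommGroup (V x)] [∀ x, Module ℝ (V x)]
    [TopologicalSpace (Bundle.TotalSpace F V)] [FiberBundle F V] [VectorBundle ℝ F V]
    {s : ∀ x, V x} {σ : E → F} (hσ : ContDiff ℝ ∞ σ)
    (hs : ∀ x y, (trivializationAt F V x ⟨y, s y⟩).2 = σ (e y)) :
    ContMDiff 𝓘(ℝ, E) (𝓘(ℝ, E).prod 𝓘(ℝ, F)) ∞ (fun x => Bundle.TotalSpace.mk' F x (s x)) := by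
  intro x
  refine (Bundle.contMDiffAt_section x).2 ?_
  simp only [hs]
  exact he.contMDiff_iff.2 (by simpa [Function.comp_def] using hσ) x

omit he in
theorem vectorField_symm_apply_self (V : ∀ x : M, TangentSpace 𝓘(ℝ, E) x) (x : M) :
    (V (e.symm (e x)) : E) = V x := by
  generalize hy : e.symm (e x) = y
  obtain rfl : y = x := by rw [← hy, e.symm_apply_apply]
  rfl

section Bundle

variable [IsManifold 𝓘(ℝ, E) ∞ M]

theorem IsGlobalChart.coordChange_eq (x y z : M) :
    (tangentBundleCore 𝓘(ℝ, E) M).coordChange (achart E x) (achart E y) z =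
      ContinuousLinearMap.id ℝ E := by
  rw [tangentBundleCore_coordChange_achart, he.extChartAt_coe, he.extChartAt_symm_coe]
  simp [Function.comp_def]

theorem IsGlobalChart.continuousLinearMapAt_eq (x y : M) :
    (trivializationAt E (TangentSpace 𝓘(ℝ, E) : M → Type _) x).continuousLinearMapAt ℝ y
      = ContinuousLinearMap.id ℝ E := by
  rw [TangentBundle.continuousLinearMapAt_trivializationAt_eq_core, he.coordChange_eq]
  simp [he x]

theorem IsGlobalChart.symmL_eq (x y : M) :
    (trivializationAt E (TangentSpace 𝓘(ℝ, E) : M → Type _) x).symmL ℝ y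
      = ContinuousLinearMap.id ℝ E := by
  rw [TangentBundle.symmL_trivializationAt_eq_core, he.coordChange_eq]
  simp [he x]

theorem IsGlobalChart.contMDiffAt_vectorField_iff {X : ∀ x : M, TangentSpace 𝓘(ℝ, E) x} {x : M} :
    ContMDiffAt 𝓘(ℝ, E) 𝓘(ℝ, E).tangent ∞
      (fun y => (⟨y, X y⟩ : TangentBundle 𝓘(ℝ, E) M)) x ↔
    ContDiffAt ℝ ∞ (fun t => (X (e.symm t) : E)) (e x) := by
  have h := Bundle.contMDiffAt_section (n := ∞) (IB := 𝓘(ℝ, E)) (F := E)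
    (E := fun x : M => TangentSpace 𝓘(ℝ, E) x) (s := X) x
  refine h.trans ?_
  have h2 : (fun y : M => (trivializationAt E (fun x : M => TangentSpace 𝓘(ℝ, E) x) x
      ⟨y, X y⟩).2) = fun y => (X y : E) := by
    funext y
    exact congrArg (fun L : E →L[ℝ] E => L (X y)) (he.coordChange_eq y x y)
  rw [h2]
  exact he.contMDiffAt_iff

theorem IsGlobalChart.contMDiff_vectorField {ξ : E → E} (h : ContDiff ℝ ∞ ξ) :
    ContMDiff 𝓘(ℝ, E) 𝓘(ℝ, E).tangent ∞
      (fun x => (⟨x, ξ (e x)⟩ : TangentBundle 𝓘(ℝ, E) M)) :=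
  fun _ => he.contMDiffAt_vectorField_iff.2 (by simpa using h.contDiffAt)

theorem IsGlobalChart.trivializationAt_covector (x y : M) (L : E →L[ℝ] ℝ) :
    (trivializationAt (E →L[ℝ] ℝ)
      (fun x : M => TangentSpace 𝓘(ℝ, E) x →L[ℝ] Bundle.Trivial M ℝ x) x ⟨y, L⟩).2 = L := by
  refine ContinuousLinearMap.ext fun v => ?_
  exact congrArg₂ (fun (S : E →L[ℝ] E) (T : ℝ →L[ℝ] ℝ) => T (L (S v))) (he.symmL_eq x y)
    (Bundle.Trivial.continuousLinearMapAt_trivialization ℝ M ℝ y)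

theorem IsGlobalChart.trivializationAt_endomorphism (x y : M) (φ : E →L[ℝ] E) :
    (trivializationAt (E →L[ℝ] E)
      (fun x : M => TangentSpace 𝓘(ℝ, E) x →L[ℝ] TangentSpace 𝓘(ℝ, E) x) x ⟨y, φ⟩).2 = φ := by
  refine ContinuousLinearMap.ext fun v => ?_
  exact congrArg₂ (fun L L' : E →L[ℝ] E => L' (φ (L v))) (he.symmL_eq x y)
    (he.continuousLinearMapAt_eq x y)

theorem IsGlobalChart.trivializationAt_bilinForm (x y : M) (g : E →L[ℝ] E →L[ℝ] ℝ) :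
    (trivializationAt (E →L[ℝ] E →L[ℝ] ℝ)
      (fun x : M => TangentSpace 𝓘(ℝ, E) x →L[ℝ] TangentSpace 𝓘(ℝ, E) x →L[ℝ] ℝ) x
      ⟨y, g⟩).2 = g := by
  refine ContinuousLinearMap.ext fun v => ContinuousLinearMap.ext fun w => ?_
  refine Eq.trans ?_ (congrArg (fun L : E →L[ℝ] E => g (L v) w) (he.symmL_eq x y))
  have hy : y ∈ (trivializationAt (E →L[ℝ] ℝ)
      (fun x : M => TangentSpace 𝓘(ℝ, E) x →L[ℝ] ℝ) x).baseSet := by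
    change y ∈ (chartAt E x).source ∩ Set.univ
    simp [he x]
  have hcoe := (trivializationAt (E →L[ℝ] ℝ)
      (fun x : M => TangentSpace 𝓘(ℝ, E) x →L[ℝ] ℝ) x).coe_linearMapAt_of_mem (R := ℝ) hy
  set S : E →L[ℝ] E := (trivializationAt E (TangentSpace 𝓘(ℝ, E) : M → Type _) x).symmL ℝ y
  exact congrArg (fun L : E →L[ℝ] ℝ => L w) ((congrFun hcoe (g (S v))).trans
    (he.trivializationAt_covector x y (g (S v))))

/-- The almost contact metric structure on a manifold with a global chart whose tensor fields are
given in the chart by smooth functions. -/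
def IsGlobalChart.almostContactMetricStructure [FiniteDimensional ℝ E]
    (g : E → E →L[ℝ] E →L[ℝ] ℝ) (ξ : E → E) (η : E → E →L[ℝ] ℝ) (φ : E → E →L[ℝ] E)
    (hg : ContDiff ℝ ∞ g) (hξ : ContDiff ℝ ∞ ξ) (hη : ContDiff ℝ ∞ η) (hφ : ContDiff ℝ ∞ φ)
    (symm : ∀ t u v, g t u v = g t v u) (pos : ∀ t v, v ≠ 0 → 0 < g t v v)
    (η_ξ : ∀ t, η t (ξ t) = 1) (φ_φ : ∀ t u, φ t (φ t u) = -u + η t u • ξ t)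
    (g_φ_φ : ∀ t u v, g t (φ t u) (φ t v) = g t u v - η t u * η t v) :
    AlmostContactMetricStructure 𝓘(ℝ, E) M where
  g :=
    { inner := fun x => g (e x)
      symm := fun x => symm (e x)
      pos := fun x => pos (e x)
      isVonNBounded := fun x => isVonNBounded_setOf_lt_one (g (e x)) (pos (e x))
      contMDiff := he.contMDiff_section
        (V := fun x : M => TangentSpace 𝓘(ℝ, E) x →L[ℝ] TangentSpace 𝓘(ℝ, E) x →L[ℝ] ℝ) hg
        fun x y => he.trivializationAt_bilinForm x y (g (e y)) }
  ξ := fun x => ξ (e x)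
  η := fun x => η (e x)
  φ := fun x => φ (e x)
  smooth_ξ := he.contMDiff_vectorField hξ
  smooth_η := he.contMDiff_section hη fun x y => he.trivializationAt_covector x y (η (e y))
  smooth_φ := he.contMDiff_section hφ fun x y => he.trivializationAt_endomorphism x y (φ (e y))
  η_ξ := fun x => η_ξ (e x)
  φ_φ := fun x => φ_φ (e x)
  g_φ_φ := fun x => g_φ_φ (e x)

theorem IsGlobalChart.differential_oneForm_apply {η : E → E →L[ℝ] ℝ} (hη : ContDiff ℝ ∞ η)
    {V : ∀ x : M, TangentSpace 𝓘(ℝ, E) x} {x : M}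
    (hV : ContMDiffAt 𝓘(ℝ, E) 𝓘(ℝ, E).tangent ∞
      (fun y => (⟨y, V y⟩ : TangentBundle 𝓘(ℝ, E) M)) x) (v : E) :
    differential 𝓘(ℝ, E) (fun y => η (e y) (V y)) x v =
      fderiv ℝ η (e x) v (V x) + η (e x) (fderiv ℝ (fun t => (V (e.symm t) : E)) (e x) v) := by
  have hη' : DifferentiableAt ℝ η (e x) := hη.differentiable (by simp) _
  have hV' : DifferentiableAt ℝ (fun t => (V (e.symm t) : E)) (e x) :=
    (he.contMDiffAt_vectorField_iff.1 hV).differentiableAt (by simp)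
  have hcomp : (fun y => η (e y) (V y)) ∘ e.symm =
      fun t => η t ((fun t => (V (e.symm t) : E)) t) := by
    funext t
    simp only [Function.comp_def, Homeomorph.apply_symm_apply]
  have hderiv := hη'.hasFDerivAt.clm_apply hV'.hasFDerivAt
  rw [← hcomp] at hderiv
  refine (congrArg (fun L : E →L[ℝ] ℝ => L v)
    ((he.differential_eq hderiv.differentiableAt).trans hderiv.fderiv)).trans ?_
  refine (add_comm (η (e x) (fderiv ℝ (fun t => (V (e.symm t) : E)) (e x) v))
    (fderiv ℝ η (e x) v (V (e.symm (e x))))).trans ?_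
  exact congrArg (fun z : E => fderiv ℝ η (e x) v z + _) (vectorField_symm_apply_self V x)

theorem IsGlobalChart.extDerivOneForm_eq {η : E → E →L[ℝ] ℝ} (hη : ContDiff ℝ ∞ η)
    {X Y : ∀ x : M, TangentSpace 𝓘(ℝ, E) x} {x : M}
    (hX : ContMDiffAt 𝓘(ℝ, E) 𝓘(ℝ, E).tangent ∞
      (fun y => (⟨y, X y⟩ : TangentBundle 𝓘(ℝ, E) M)) x)
    (hY : ContMDiffAt 𝓘(ℝ, E) 𝓘(ℝ, E).tangent ∞
      (fun y => (⟨y, Y y⟩ : TangentBundle 𝓘(ℝ, E) M)) x) :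
    extDerivOneForm 𝓘(ℝ, E) (fun x => η (e x)) X Y x =
      (1 / 2) * (fderiv ℝ η (e x) (X x) (Y x) - fderiv ℝ η (e x) (Y x) (X x)) := by
  have hbracket : η (e x) (VectorField.mlieBracket 𝓘(ℝ, E) X Y x) =
      η (e x) (fderiv ℝ (fun t => (Y (e.symm t) : E)) (e x) (X x)) -
        η (e x) (fderiv ℝ (fun t => (X (e.symm t) : E)) (e x) (Y x)) := by
    refine (congrArg (η (e x)) (he.mlieBracket_eq X Y x)).trans ?_
    refine (map_sub (η (e x)) _ _).trans ?_
    exact congrArg₂ (fun a b : E => η (e x) (fderiv ℝ (fun t => (Y (e.symm t) : E)) (e x) a) -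
      η (e x) (fderiv ℝ (fun t => (X (e.symm t) : E)) (e x) b))
      (vectorField_symm_apply_self X x) (vectorField_symm_apply_self Y x)
  refine (congrArg (fun r : ℝ => 1 / 2 * r) (congrArg₂ (· - ·) (congrArg₂ (· - ·)
    (he.differential_oneForm_apply hη hY (X x)) (he.differential_oneForm_apply hη hX (Y x)))
    hbracket)).trans ?_
  ring

end Bundle

end GlobalChart

open Matrix

/-! ### Exponentials of matrices acting on vectors -/

section Exp

variable {ι : Type*} [Fintype ι] [DecidableEq ι]

theorem hasSum_exp_mulVec (X : Matrix ι ι ℝ) (v : ι → ℝ) :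
    HasSum (fun k : ℕ => (k.factorial : ℝ)⁻¹ • ((X ^ k) *ᵥ v)) (NormedSpace.exp X *ᵥ v) := by
  have hcont : Continuous (mulVec.addMonoidHomLeft v : Matrix ι ι ℝ →+ ι → ℝ) :=
    continuous_id.matrix_mulVec continuous_const
  convert! (NormedSpace.exp_series_hasSum_exp' (𝕂 := ℝ) X).map _ hcont using 2 with k
  exact (smul_mulVec _ _ _).symm

theorem exp_mulVec_sub_mem {X : Matrix ι ι ℝ} {W : Submodule ℝ (ι → ℝ)}
    (hW : ∀ w ∈ W, X *ᵥ w ∈ W) {v : ι → ℝ} {ρ : ℝ} (hv : X *ᵥ v - ρ • v ∈ W) :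
    NormedSpace.exp X *ᵥ v - Real.exp ρ • v ∈ W := by
  have hpow (k : ℕ) : (X ^ k) *ᵥ v - ρ ^ k • v ∈ W := by
    induction k with
    | zero => simp
    | succ k ih =>
      have hsucc : (X ^ (k + 1)) *ᵥ v - ρ ^ (k + 1) • v =
          X *ᵥ ((X ^ k) *ᵥ v - ρ ^ k • v) + ρ ^ k • (X *ᵥ v - ρ • v) := by
        rw [pow_succ', ← mulVec_mulVec, mulVec_sub, mulVec_smul, smul_sub, smul_smul, pow_succ]
        abel
      rw [hsucc]
      exact W.add_mem (hW _ ih) (W.smul_mem _ hv)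
  have hsum : HasSum (fun k : ℕ => (k.factorial : ℝ)⁻¹ • ((X ^ k) *ᵥ v - ρ ^ k • v))
      (NormedSpace.exp X *ᵥ v - Real.exp ρ • v) := by
    have hexp := (NormedSpace.expSeries_div_hasSum_exp ρ).smul_const v
    rw [← Real.exp_eq_exp_ℝ] at hexp
    convert! (hasSum_exp_mulVec X v).sub hexp using 2 with k
    rw [smul_sub, smul_smul, div_eq_inv_mul]
  exact (Submodule.closed_of_finiteDimensional W).mem_of_tendsto hsum
    (Filter.Eventually.of_forall fun s => W.sum_mem fun k _ => W.smul_mem _ (hpow k))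

theorem exp_mulVec_of_eigenvector {X : Matrix ι ι ℝ} {v : ι → ℝ} {ρ : ℝ} (hv : X *ᵥ v = ρ • v) :
    NormedSpace.exp X *ᵥ v = Real.exp ρ • v := by
  simpa [sub_eq_zero] using
    exp_mulVec_sub_mem (X := X) (W := ⊥) (v := v) (ρ := ρ) (by simp) (by simp [hv])

theorem exp_mulVec_of_cube {X : Matrix ι ι ℝ} {v : ι → ℝ} (hv : X *ᵥ (X *ᵥ (X *ᵥ v)) = 0) :
    NormedSpace.exp X *ᵥ v = v + X *ᵥ v + (1 / 2 : ℝ) • (X *ᵥ (X *ᵥ v)) := by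
  have hcube : (X ^ 3) *ᵥ v = 0 := by
    simpa [pow_succ, mul_assoc] using hv
  have hzero : ∀ k ∉ Finset.range 3, (k.factorial : ℝ)⁻¹ • ((X ^ k) *ᵥ v) = 0 := by
    intro k hk
    obtain ⟨m, rfl⟩ := Nat.exists_eq_add_of_le' (not_lt.1 (fun h => hk (Finset.mem_range.2 h)))
    rw [pow_add, ← mulVec_mulVec, hcube, mulVec_zero, smul_zero]
  rw [(hasSum_exp_mulVec X v).unique (hasSum_sum_of_ne_finset_zero hzero)]
  simp [Finset.sum_range_succ, pow_two]

/-- The exponential as an invertible matrix. -/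
def expGL (X : Matrix ι ι ℝ) : GL ι ℝ where
  val := NormedSpace.exp X
  inv := NormedSpace.exp (-X)
  val_inv := by
    rw [← exp_add_of_commute _ _ (Commute.neg_right (Commute.refl X)), add_neg_cancel,
      NormedSpace.exp_zero]
  inv_val := by
    rw [← exp_add_of_commute _ _ (Commute.neg_left (Commute.refl X)), neg_add_cancel,
      NormedSpace.exp_zero]

theorem coe_expGL (X : Matrix ι ι ℝ) : (expGL X : Matrix ι ι ℝ) = NormedSpace.exp X := rfl

theorem continuous_expGL : Continuous (expGL : Matrix ι ι ℝ → GL ι ℝ) := by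
  let _ : NormedAlgebra ℚ (Matrix ι ι ℝ) := NormedAlgebra.restrictScalars ℚ ℝ (Matrix ι ι ℝ)
  have hexp : Continuous (NormedSpace.exp : Matrix ι ι ℝ → Matrix ι ι ℝ) :=
    NormedSpace.exp_continuous
  exact Units.continuous_iff.2 ⟨hexp, hexp.comp continuous_neg⟩

end Exp

/-! ### The form of signature `(2, n + 1)` and its isometries -/

section Form

variable {n : ℕ}

/-- Vectors of `ℝ^{n+3}`. -/
abbrev Vec (n : ℕ) : Type := Idx n → ℝ

/-- The vector with coordinates `a, b`, then `c, d`, then `f`, in the blocks of sizes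
`2, 2, n - 1`. -/
def vec (a b c d : ℝ) (f : Fin (n - 1) → ℝ) : Vec n :=
  Sum.elim ![a, b] (Sum.elim ![c, d] f)

theorem exists_eq_vec (x : Vec n) : ∃ a b c d f, x = vec a b c d f := by
  refine ⟨x (.inl 0), x (.inl 1), x (.inr (.inl 0)), x (.inr (.inl 1)),
    fun i => x (.inr (.inr i)), ?_⟩
  ext (i | i | i)
  · fin_cases i <;> rfl
  · fin_cases i <;> rfl
  · rfl

theorem vec_eq_vec_iff {a b c d a' b' c' d' : ℝ} {f f' : Fin (n - 1) → ℝ} :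
    (vec a b c d f : Vec n) = vec a' b' c' d' f' ↔
      a = a' ∧ b = b' ∧ c = c' ∧ d = d' ∧ f = f' := by
  refine ⟨fun h => ⟨congrFun h (.inl 0), congrFun h (.inl 1), congrFun h (.inr (.inl 0)),
    congrFun h (.inr (.inl 1)), funext fun i => congrFun h (.inr (.inr i))⟩, ?_⟩
  rintro ⟨rfl, rfl, rfl, rfl, rfl⟩
  rfl

theorem vec_add (a b c d a' b' c' d' : ℝ) (f f' : Fin (n - 1) → ℝ) :
    (vec a b c d f : Vec n) + vec a' b' c' d' f' =
      vec (a + a') (b + b') (c + c') (d + d') (f + f') := by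
  ext (i | i | i)
  · fin_cases i <;> rfl
  · fin_cases i <;> rfl
  · rfl

theorem smul_vec (r a b c d : ℝ) (f : Fin (n - 1) → ℝ) :
    r • (vec a b c d f : Vec n) = vec (r * a) (r * b) (r * c) (r * d) (r • f) := by
  ext (i | i | i)
  · fin_cases i <;> rfl
  · fin_cases i <;> rfl
  · rfl

theorem vec_sub (a b c d a' b' c' d' : ℝ) (f f' : Fin (n - 1) → ℝ) :
    (vec a b c d f : Vec n) - vec a' b' c' d' f' =
      vec (a - a') (b - b') (c - c') (d - d') (f - f') := by
  ext (i | i | i)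
  · fin_cases i <;> rfl
  · fin_cases i <;> rfl
  · rfl

theorem vec_zero : (vec 0 0 0 0 0 : Vec n) = 0 := by
  simpa using (smul_vec 0 0 0 0 0 (0 : Fin (n - 1) → ℝ)).symm

theorem mat_ext_mulVec {X Y : Mat n} (h : ∀ x, X *ᵥ x = Y *ᵥ x) : X = Y :=
  ext_of_mulVec_single fun _ => h _

theorem block_mulVec (p q r s : Matrix (Fin 2) (Fin 2) ℝ) (a b c d : ℝ) (f : Fin (n - 1) → ℝ) :
    block n p q r s *ᵥ vec a b c d f =
      vec (p 0 0 * a + p 0 1 * b + (q 0 0 * c + q 0 1 * d))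
        (p 1 0 * a + p 1 1 * b + (q 1 0 * c + q 1 1 * d))
        (r 0 0 * a + r 0 1 * b + (s 0 0 * c + s 0 1 * d))
        (r 1 0 * a + r 1 1 * b + (s 1 0 * c + s 1 1 * d)) 0 := by
  ext (i | i | i)
  · fin_cases i <;> simp [block, vec, mulVec, dotProduct, Fin.sum_univ_two]
  · fin_cases i <;> simp [block, vec, mulVec, dotProduct, Fin.sum_univ_two]
  · simp [block, vec, mulVec, dotProduct]

theorem contDiff_vec {E : Type*} [NormedAddCommGroup E] [NormedSpace ℝ E] {k : WithTop ℕ∞}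
    {a b c d : E → ℝ} {f : E → Fin (n - 1) → ℝ} (ha : ContDiff ℝ k a) (hb : ContDiff ℝ k b)
    (hc : ContDiff ℝ k c) (hd : ContDiff ℝ k d) (hf : ContDiff ℝ k f) :
    ContDiff ℝ k fun x => (vec (a x) (b x) (c x) (d x) (f x) : Vec n) := by
  refine contDiff_pi.2 ?_
  rintro (i | i | i)
  · fin_cases i
    exacts [ha, hb]
  · fin_cases i
    exacts [hc, hd]
  · exact contDiff_pi.1 hf i

theorem contDiff_mulVec {E : Type*} [NormedAddCommGroup E] [NormedSpace ℝ E] {k : WithTop ℕ∞}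
    {f : E → Mat n} {g : E → Vec n} (hf : ContDiff ℝ k f) (hg : ContDiff ℝ k g) :
    ContDiff ℝ k fun x => f x *ᵥ g x :=
  ((mulVecBilin ℝ ℝ : Mat n →ₗ[ℝ] Vec n →ₗ[ℝ] Vec n).toContinuousBilinearMap.contDiff.comp
    hf).clm_apply hg

/-- The symmetric bilinear form with matrix `diag (1, 1, -1, …, -1)`; with this sign the planes of
the Grassmannian are positive definite. -/
def form : Vec n →L[ℝ] Vec n →L[ℝ] ℝ :=
  (toLinearMap₂' ℝ (LieAlgebra.Orthogonal.indefiniteDiagonal (Fin 2) (Fin 2 ⊕ Fin (n - 1))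
    ℝ)).toContinuousBilinearMap

theorem form_vec (a b c d a' b' c' d' : ℝ) (f f' : Fin (n - 1) → ℝ) :
    form (vec a b c d f : Vec n) (vec a' b' c' d' f') =
      a * a' + b * b' - c * c' - d * d' - f ⬝ᵥ f' := by
  simp only [form, LinearMap.toContinuousBilinearMap_apply, toLinearMap₂'_apply',
    LieAlgebra.Orthogonal.indefiniteDiagonal, mulVec_diagonal, dotProduct, Fintype.sum_sum_type,
    Fin.sum_univ_two, vec, Sum.elim_inl, Sum.elim_inr, cons_val_zero, cons_val_one, neg_mul,
    mul_neg, one_mul, Finset.sum_neg_distrib]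
  ring

theorem form_comm (x y : Vec n) : form x y = form y x := by
  obtain ⟨a, b, c, d, f, rfl⟩ := exists_eq_vec x
  obtain ⟨a', b', c', d', f', rfl⟩ := exists_eq_vec y
  rw [form_vec, form_vec, dotProduct_comm]
  ring

theorem mem_so_iff {X : Mat n} : X ∈ so n ↔ ∀ x y, form (X *ᵥ x) y = -form x (X *ᵥ y) := by
  rw [so, mem_skewAdjointMatricesSubmodule, Matrix.IsSkewAdjoint, ← isAdjointPair_toLinearMap₂']
  simp only [LinearMap.IsAdjointPair, map_neg, LinearMap.neg_apply, toLin'_apply]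
  rfl

theorem form_exp_mulVec {X : Mat n} (hX : X ∈ so n) (x y : Vec n) :
    form (NormedSpace.exp X *ᵥ x) y = form x (NormedSpace.exp (-X) *ᵥ y) := by
  have hpow (k : ℕ) (x y : Vec n) : form ((X ^ k) *ᵥ x) y = form x (((-X) ^ k) *ᵥ y) := by
    induction k generalizing x with
    | zero => simp
    | succ k ih =>
      rw [pow_succ, ← mulVec_mulVec, ih, pow_succ' (-X), ← mulVec_mulVec, neg_mulVec, map_neg,
        mem_so_iff.1 hX]
  refine ((hasSum_exp_mulVec X x).mapL (form.flip y)).unique ?_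
  convert! (hasSum_exp_mulVec (-X) y).mapL (form x) using 2 with k
  simp [hpow]

theorem contDiff_form {E : Type*} [NormedAddCommGroup E] [NormedSpace ℝ E] {k : WithTop ℕ∞}
    {f g : E → Vec n} (hf : ContDiff ℝ k f) (hg : ContDiff ℝ k g) :
    ContDiff ℝ k fun x => form (f x) (g x) :=
  ((form (n := n)).contDiff.comp hf).clm_apply hg

/-- The group `O(2, n + 1)`. -/
def isometryGroup (n : ℕ) : Subgroup (GL (Idx n) ℝ) where
  carrier := {a | ∀ x y, form ((a : Mat n) *ᵥ x) ((a : Mat n) *ᵥ y) = form x y}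
  one_mem' := fun x y => by simp
  mul_mem' := fun {a b} ha hb x y => by
    rw [Units.val_mul, ← mulVec_mulVec, ← mulVec_mulVec, ha, hb]
  inv_mem' := fun {a} ha x y => by
    rw [← ha, mulVec_mulVec, mulVec_mulVec, Units.mul_inv, one_mulVec, one_mulVec]

theorem mem_isometryGroup_of_exp {X : Mat n} (hX : X ∈ so n) {a : GL (Idx n) ℝ}
    (ha : (a : Mat n) = NormedSpace.exp X) : a ∈ isometryGroup n := by
  intro x y
  rw [ha, form_exp_mulVec hX, mulVec_mulVec,
    ← exp_add_of_commute _ _ (Commute.neg_left (Commute.refl X)), neg_add_cancel,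
    NormedSpace.exp_zero, one_mulVec]

theorem SO₀_le_isometryGroup : SO₀ n ≤ isometryGroup n :=
  (Subgroup.closure_le _).2 fun _ ⟨_, hX, ha⟩ => mem_isometryGroup_of_exp hX ha

/-! ### Bivectors -/

/-- The infinitesimal rotation `v ↦ ⟨y, v⟩ x - ⟨x, v⟩ y`, which identifies bivectors with
`𝔰𝔬(2, n + 1)`. The point of the Grassmannian given by a plane with oriented orthonormal basis
`x, y` is `wedge x y`. -/
def wedge : Vec n →L[ℝ] Vec n →L[ℝ] Mat n :=
  LinearMap.toContinuousBilinearMap <| LinearMap.mk₂ ℝ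
    (fun x y => LinearMap.toMatrix' ((form y).toLinearMap.smulRight x -
      (form x).toLinearMap.smulRight y))
    (fun x x' y => by ext; simp; ring) (fun r x y => by ext; simp; ring)
    (fun x y y' => by ext; simp; ring) (fun r x y => by ext; simp; ring)

theorem wedge_mulVec (x y v : Vec n) : wedge x y *ᵥ v = form y v • x - form x v • y := by
  rw [wedge, LinearMap.toContinuousBilinearMap_apply, LinearMap.mk₂_apply,
    LinearMap.toMatrix'_mulVec]
  rfl

theorem wedge_swap (x y : Vec n) : wedge x y = -wedge y x := by
  refine mat_ext_mulVec fun v => ?_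
  rw [neg_mulVec, wedge_mulVec, wedge_mulVec, neg_sub]

theorem wedge_self (x : Vec n) : wedge x x = 0 := by
  refine mat_ext_mulVec fun v => ?_
  rw [wedge_mulVec, sub_self, zero_mulVec]

theorem wedge_mem_so (x y : Vec n) : wedge x y ∈ so n := by
  refine mem_so_iff.2 fun v w => ?_
  simp only [wedge_mulVec, map_sub, map_smul, _root_.sub_apply, _root_.smul_apply,
    smul_eq_mul, form_comm v]
  ring

theorem velocity_wedge {X : Mat n} (hX : X ∈ so n) (x y : Vec n) :
    velocity X (wedge x y) = wedge (X *ᵥ x) y + wedge x (X *ᵥ y) := by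
  refine mat_ext_mulVec fun v => ?_
  simp only [velocity, sub_mulVec, add_mulVec, ← mulVec_mulVec, wedge_mulVec, mulVec_sub,
    mulVec_smul, mem_so_iff.1 hX, neg_smul]
  abel

theorem Ad_wedge {a : GL (Idx n) ℝ} (ha : a ∈ isometryGroup n) (x y : Vec n) :
    Ad a (wedge x y) = wedge ((a : Mat n) *ᵥ x) ((a : Mat n) *ᵥ y) := by
  refine mat_ext_mulVec fun v => ?_
  have hinv (z : Vec n) :
      form z (((a⁻¹ : GL (Idx n) ℝ) : Mat n) *ᵥ v) = form ((a : Mat n) *ᵥ z) v := by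
    rw [← ha, mulVec_mulVec, Units.mul_inv, one_mulVec]
  simp only [Ad, ← mulVec_mulVec, wedge_mulVec, mulVec_sub, mulVec_smul, hinv]

theorem trace_mul_wedge (X : Mat n) (x y : Vec n) :
    trace (X * wedge x y) = form y (X *ᵥ x) - form x (X *ᵥ y) := by
  have hlin : toLin' (X * wedge x y) = (form y).toLinearMap.smulRight (X *ᵥ x) -
      (form x).toLinearMap.smulRight (X *ᵥ y) := by
    refine LinearMap.ext fun v => ?_
    simp [wedge_mulVec, mulVec_sub, mulVec_smul]
  calc trace (X * wedge x y) = LinearMap.trace ℝ (Vec n) (toLin' (X * wedge x y)) := by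
        rw [LinearMap.trace_eq_matrix_trace ℝ (Pi.basisFun ℝ (Idx n)),
          LinearMap.toMatrix_eq_toMatrix', LinearMap.toMatrix'_toLin']
    _ = form y (X *ᵥ x) - form x (X *ᵥ y) := by
        simp only [hlin, map_sub, LinearMap.trace_smulRight, ContinuousLinearMap.coe_coe]

theorem c₀_sq : c₀ ^ 2 = 8 := by
  rw [c₀, mul_pow, Real.sq_sqrt (by norm_num)]
  norm_num

theorem metric_wedge (x y z w : Vec n) : metric (wedge x y) (wedge z w) =
    (1 / 4) * (form y z * form x w - form x z * form y w) := by
  rw [metric, trace_mul_wedge, c₀_sq]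
  simp only [wedge_mulVec, map_sub, map_smul, smul_eq_mul, form_comm w, form_comm z,
    _root_.sub_apply, _root_.smul_apply]
  ring

theorem exp_wedge_mulVec {w ℓ : Vec n} (hℓ : form ℓ ℓ = 0) (hw : form w ℓ = 0) (x : Vec n) :
    NormedSpace.exp (wedge w ℓ) *ᵥ x =
      x + form ℓ x • w - (form w x + form ℓ x * form w w / 2) • ℓ := by
  have hmul_ℓ : wedge w ℓ *ᵥ ℓ = 0 := by simp [wedge_mulVec, hℓ, hw]
  have hmul_w : wedge w ℓ *ᵥ w = -form w w • ℓ := by simp [wedge_mulVec, form_comm ℓ w, hw]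
  have hmul_mul : wedge w ℓ *ᵥ (wedge w ℓ *ᵥ x) = -(form ℓ x * form w w) • ℓ := by
    rw [wedge_mulVec w ℓ x, mulVec_sub, mulVec_smul, mulVec_smul, hmul_ℓ, hmul_w]
    module
  rw [exp_mulVec_of_cube (by rw [hmul_mul, mulVec_smul, hmul_ℓ, smul_zero]), hmul_mul,
    wedge_mulVec]
  module

end Form

local notation "e₁" => vec 1 0 0 0 0
local notation "e₂" => vec 0 1 0 0 0

/-! ### The geometry of the Grassmannian in terms of frames -/

section Metric

variable {n : ℕ}

/-- The metric as a continuous bilinear map. -/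
def metricL (n : ℕ) : Mat n →L[ℝ] Mat n →L[ℝ] ℝ :=
  (LinearMap.mk₂ ℝ (metric : Mat n → Mat n → ℝ)
    (fun u v w => by simp only [metric, add_mul, trace_add, mul_add])
    (fun r u v => by simp only [metric, smul_mul_assoc, trace_smul, smul_eq_mul]; ring)
    (fun u v w => by simp only [metric, mul_add, trace_add])
    (fun r u v => by
      simp only [metric, mul_smul_comm, trace_smul, smul_eq_mul]; ring)).toContinuousBilinearMap

theorem metricL_apply (u v : Mat n) : metricL n u v = metric u v := rfl

/-- The complex structure as a continuous bilinear map. -/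
def JL (n : ℕ) : Mat n →L[ℝ] Mat n →L[ℝ] Mat n :=
  (LinearMap.mk₂ ℝ (J : Mat n → Mat n → Mat n)
    (fun u v w => by simp only [J, add_mul, mul_add]; abel)
    (fun r u v => by simp only [J, smul_mul_assoc, mul_smul_comm, smul_sub])
    (fun u v w => by simp only [J, add_mul, mul_add]; abel)
    (fun r u v => by
      simp only [J, smul_mul_assoc, mul_smul_comm, smul_sub])).toContinuousBilinearMap

theorem JL_apply (p u : Mat n) : JL n p u = J p u := rfl

theorem metric_comm (u v : Mat n) : metric u v = metric v u := by
  rw [metric, metric, trace_mul_comm]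

theorem metric_sub_smul_left (u v w : Mat n) (r : ℝ) :
    metric (u - r • v) w = metric u w - r * metric v w := by
  simp only [← metricL_apply, map_sub, map_smul, _root_.sub_apply, _root_.smul_apply, smul_eq_mul]

theorem metric_neg_right (u v : Mat n) : metric u (-v) = -metric u v := map_neg (metricL n u) v

theorem metric_J_left (p u v : Mat n) : metric (J p u) v = -metric u (J p v) := by
  have hcycle : trace (p * u * v) = trace (u * v * p) := by rw [mul_assoc, trace_mul_comm]
  simp only [metric, J, sub_mul, mul_sub, trace_sub, ← mul_assoc, hcycle]
  ring

theorem metric_J_self (p u : Mat n) : metric u (J p u) = 0 := by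
  linarith [metric_J_left p u u, metric_comm (J p u) u]

/-- The tangent space of the Grassmannian at its point `p`. -/
def tangentSubmodule (p : Mat n) : Submodule ℝ (Mat n) where
  carrier := {u | IsTangent p u}
  zero_mem' := ⟨0, zero_mem _, by simp [velocity]⟩
  add_mem' := by
    rintro _ _ ⟨X, hX, rfl⟩ ⟨Y, hY, rfl⟩
    refine ⟨X + Y, add_mem hX hY, ?_⟩
    simp only [velocity, add_mul, mul_add]
    abel
  smul_mem' := by
    rintro r _ ⟨X, hX, rfl⟩
    refine ⟨r • X, Submodule.smul_mem _ r hX, ?_⟩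
    simp only [velocity, smul_mul_assoc, mul_smul_comm, smul_sub]

theorem mem_tangentSubmodule {p u : Mat n} : u ∈ tangentSubmodule p ↔ IsTangent p u := Iff.rfl

end Metric

section Frame

variable {n : ℕ} {x y : Vec n}

theorem Z_eq_wedge : Z n = wedge e₁ e₂ := by
  refine mat_ext_mulVec fun v => ?_
  obtain ⟨a, b, c, d, f, rfl⟩ := exists_eq_vec v
  rw [Z, block_mulVec, wedge_mulVec, form_vec, form_vec, smul_vec, smul_vec, vec_sub]
  simp [U]

/-- The orthogonal complement of the plane spanned by `x` and `y`. -/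
def planePerp (x y : Vec n) : Submodule ℝ (Vec n) :=
  (form x).toLinearMap.ker ⊓ (form y).toLinearMap.ker

theorem mem_planePerp {u : Vec n} : u ∈ planePerp x y ↔ form x u = 0 ∧ form y u = 0 := Iff.rfl

/-- `x, y` is an orthonormal basis of a plane with negative definite orthogonal complement. -/
structure IsPositiveFrame (x y : Vec n) : Prop where
  fst_fst : form x x = 1
  snd_snd : form y y = 1
  fst_snd : form x y = 0
  neg_of_mem_planePerp : ∀ u ∈ planePerp x y, u ≠ 0 → form u u < 0

theorem isPositiveFrame_of_mem_isometryGroup {a : GL (Idx n) ℝ} (ha : a ∈ isometryGroup n) :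
    IsPositiveFrame ((a : Mat n) *ᵥ e₁) ((a : Mat n) *ᵥ e₂) where
  fst_fst := by simp [ha _ _, form_vec]
  snd_snd := by simp [ha _ _, form_vec]
  fst_snd := by simp [ha _ _, form_vec]
  neg_of_mem_planePerp u hu hu0 := by
    obtain ⟨v, rfl⟩ : ∃ v, (a : Mat n) *ᵥ v = u :=
      ⟨((a⁻¹ : GL (Idx n) ℝ) : Mat n) *ᵥ u, by rw [mulVec_mulVec, Units.mul_inv, one_mulVec]⟩
    obtain ⟨a', b, c, d, f, rfl⟩ := exists_eq_vec v
    rw [mem_planePerp, ha, ha, form_vec, form_vec] at hu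
    obtain ⟨rfl, rfl⟩ : a' = 0 ∧ b = 0 := by simpa using hu
    rw [ha, form_vec]
    have hf : 0 ≤ f ⬝ᵥ f := dotProduct_self_star_nonneg f
    by_contra! hnonneg
    have hcdf : c = 0 ∧ d = 0 ∧ f = 0 := by
      refine ⟨?_, ?_, dotProduct_self_eq_zero.1 ?_⟩ <;> nlinarith
    exact hu0 (by simp [hcdf, vec_zero])

theorem exists_isPositiveFrame {p : Mat n} (hp : p ∈ grassmannian n) :
    ∃ x y, IsPositiveFrame x y ∧ p = wedge x y := by
  obtain ⟨a, ha, rfl⟩ := hp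
  have ha' := SO₀_le_isometryGroup ha
  exact ⟨_, _, isPositiveFrame_of_mem_isometryGroup ha', by rw [Z_eq_wedge, Ad_wedge ha']⟩

/-- The velocity of the plane spanned by `x, y` when `x` and `y` have the velocities `u` and `v`. -/
def planeVelocity (x y u v : Vec n) : Mat n := wedge u y + wedge x v

namespace IsPositiveFrame

variable (h : IsPositiveFrame x y)
include h

theorem isTangent_wedge_iff {w : Mat n} : IsTangent (wedge x y) w ↔
    ∃ u ∈ planePerp x y, ∃ v ∈ planePerp x y, w = planeVelocity x y u v := by
  have hyx : form y x = 0 := by rw [form_comm, h.fst_snd]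
  constructor
  · rintro ⟨X, hX, rfl⟩
    have hskew (z : Vec n) : form z (X *ᵥ z) = 0 := by
      have := mem_so_iff.1 hX z z
      rw [form_comm] at this
      linarith
    refine ⟨X *ᵥ x - form y (X *ᵥ x) • y, ?_, X *ᵥ y - form x (X *ᵥ y) • x, ?_, ?_⟩
    · simp [mem_planePerp, hskew, h.fst_snd, h.snd_snd]
    · simp [mem_planePerp, hskew, hyx, h.fst_fst]
    · simp [velocity_wedge hX, planeVelocity, wedge_self]
  · rintro ⟨u, ⟨hux, huy⟩, v, ⟨hvx, hvy⟩, rfl⟩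
    refine ⟨wedge u x + wedge v y, add_mem (wedge_mem_so _ _) (wedge_mem_so _ _), ?_⟩
    simp_all [velocity_wedge, add_mem, wedge_mem_so, wedge_mulVec, planeVelocity, add_mulVec,
      h.fst_fst, h.snd_snd, h.fst_snd, form_comm u, form_comm v]

theorem finrank_planePerp : Module.finrank ℝ (planePerp x y) = (n - 1) + 2 := by
  have hyx : form y x = 0 := by rw [form_comm, h.fst_snd]
  have hsurj : ((form x).toLinearMap.prod (form y).toLinearMap).range = ⊤ := by
    refine LinearMap.range_eq_top.2 fun r => ⟨r.1 • x + r.2 • y, ?_⟩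
    simp [h.fst_fst, h.snd_snd, h.fst_snd, hyx]
  have hrank := ((form x).toLinearMap.prod (form y).toLinearMap).finrank_range_add_finrank_ker
  rw [hsurj, finrank_top, LinearMap.ker_prod] at hrank
  simp only [Module.finrank_prod, Module.finrank_self, Module.finrank_fintype_fun_eq_card,
    Fintype.card_sum, Fintype.card_fin] at hrank
  rw [planePerp]
  omega

theorem J_planeVelocity {u v : Vec n} (hu : u ∈ planePerp x y) (hv : v ∈ planePerp x y) :
    J (wedge x y) (planeVelocity x y u v) = planeVelocity x y v (-u) := by
  obtain ⟨hxu, hyu⟩ := mem_planePerp.1 hu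
  obtain ⟨hxv, hyv⟩ := mem_planePerp.1 hv
  have hyx : form y x = 0 := by rw [form_comm, h.fst_snd]
  calc J (wedge x y) (planeVelocity x y u v)
      = velocity (wedge x y) (wedge u y) + velocity (wedge x y) (wedge x v) := by
        simp only [J, velocity, planeVelocity, mul_add, add_mul]
        abel
    _ = wedge u x - wedge y v := by
        simp [velocity_wedge (wedge_mem_so x y), wedge_mulVec, hxu, hyu, hxv, hyv, hyx, h.fst_fst,
          h.snd_snd, h.fst_snd, sub_eq_add_neg]
    _ = planeVelocity x y v (-u) := by
        rw [planeVelocity, map_neg, wedge_swap u, wedge_swap y]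
        abel

theorem metric_planeVelocity {u v u' v' : Vec n} (hu : u ∈ planePerp x y) (hv : v ∈ planePerp x y)
    (hu' : u' ∈ planePerp x y) (hv' : v' ∈ planePerp x y) :
    metric (planeVelocity x y u v) (planeVelocity x y u' v') =
      -(1 / 4) * (form u u' + form v v') := by
  obtain ⟨⟨hxu, hyu⟩, hxv, hyv⟩ := And.intro (mem_planePerp.1 hu) (mem_planePerp.1 hv)
  obtain ⟨⟨hxu', hyu'⟩, hxv', hyv'⟩ := And.intro (mem_planePerp.1 hu') (mem_planePerp.1 hv')
  simp only [planeVelocity, ← metricL_apply, map_add, _root_.add_apply]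
  simp only [metricL_apply, metric_wedge, h.fst_fst, h.snd_snd,
    h.fst_snd, form_comm _ x, form_comm _ y, hxu, hyu, hxv, hyv, hxu', hyu', hxv', hyv']
  ring

end IsPositiveFrame

variable {p u : Mat n}

theorem isTangent_J (hp : p ∈ grassmannian n) (hu : IsTangent p u) : IsTangent p (J p u) := by
  obtain ⟨x, y, h, rfl⟩ := exists_isPositiveFrame hp
  obtain ⟨a, ha, b, hb, rfl⟩ := h.isTangent_wedge_iff.1 hu
  exact h.isTangent_wedge_iff.2 ⟨b, hb, -a, neg_mem ha, h.J_planeVelocity ha hb⟩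

theorem J_J (hp : p ∈ grassmannian n) (hu : IsTangent p u) : J p (J p u) = -u := by
  obtain ⟨x, y, h, rfl⟩ := exists_isPositiveFrame hp
  obtain ⟨a, ha, b, hb, rfl⟩ := h.isTangent_wedge_iff.1 hu
  rw [h.J_planeVelocity ha hb, h.J_planeVelocity hb (neg_mem ha)]
  simp only [planeVelocity, map_neg, _root_.neg_apply, neg_add]

theorem metric_self_pos (hp : p ∈ grassmannian n) (hu : IsTangent p u) (hu0 : u ≠ 0) :
    0 < metric u u := by
  obtain ⟨x, y, h, rfl⟩ := exists_isPositiveFrame hp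
  obtain ⟨a, ha, b, hb, rfl⟩ := h.isTangent_wedge_iff.1 hu
  rw [h.metric_planeVelocity ha hb ha hb]
  have hnonpos (z : Vec n) (hz : z ∈ planePerp x y) : form z z ≤ 0 := by
    obtain rfl | hz0 := eq_or_ne z 0
    · simp
    · exact (h.neg_of_mem_planePerp z hz hz0).le
  have hab : a ≠ 0 ∨ b ≠ 0 := by
    by_contra! hab
    exact hu0 (by simp [planeVelocity, hab])
  obtain ha0 | hb0 := hab
  · linarith [h.neg_of_mem_planePerp a ha ha0, hnonpos b hb]
  · linarith [h.neg_of_mem_planePerp b hb hb0, hnonpos a ha]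

theorem finrank_tangentSubmodule_le (hp : p ∈ grassmannian n) :
    Module.finrank ℝ (tangentSubmodule p) ≤ 2 * (n - 1) + 4 := by
  obtain ⟨x, y, h, rfl⟩ := exists_isPositiveFrame hp
  let L : planePerp x y × planePerp x y →ₗ[ℝ] Mat n :=
    (((wedge.flip y).toLinearMap ∘ₗ (planePerp x y).subtype).coprod
      ((wedge x).toLinearMap ∘ₗ (planePerp x y).subtype))
  have hrange : tangentSubmodule (wedge x y) ≤ L.range := by
    intro w hw
    obtain ⟨u, hu, v, hv, rfl⟩ := h.isTangent_wedge_iff.1 hw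
    exact ⟨(⟨u, hu⟩, ⟨v, hv⟩), rfl⟩
  calc Module.finrank ℝ (tangentSubmodule (wedge x y))
      ≤ Module.finrank ℝ L.range := Submodule.finrank_mono hrange
    _ ≤ Module.finrank ℝ (planePerp x y × planePerp x y) := L.finrank_range_le
    _ = 2 * (n - 1) + 4 := by
      rw [Module.finrank_prod, h.finrank_planePerp]
      omega

theorem isTangent_iff_of_finrank (hp : p ∈ grassmannian n) {E : Type*} [AddCommGroup E]
    [Module ℝ E] [FiniteDimensional ℝ E] (hdim : Module.finrank ℝ E = 2 * (n - 1) + 3)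
    {D : E →ₗ[ℝ] Mat n} (hD : Function.Injective D) (hDp : ∀ u, IsTangent p (D u)) {ν : Mat n}
    (hν : IsTangent p ν) (hunit : metric ν ν = 1) (hnormal : ∀ u, metric (D u) ν = 0) {w : Mat n} :
    IsTangent p w ↔ ∃ (u : E) (r : ℝ), w = D u + r • ν := by
  let L : E × ℝ →ₗ[ℝ] Mat n := D.coprod (LinearMap.toSpanSingleton ℝ _ ν)
  have hL : Function.Injective L := by
    refine (injective_iff_map_eq_zero L).2 fun ⟨u, r⟩ hur => ?_
    have hur' : D u + r • ν = 0 := hur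
    have hr : r = 0 := by
      have := congrArg (metricL n · ν) hur'
      simpa [metricL_apply, hnormal, hunit] using this
    have hu : D u = 0 := by simpa [hr] using hur'
    rw [hr, (map_eq_zero_iff D hD).1 hu, Prod.mk_zero_zero]
  have hle : L.range ≤ tangentSubmodule p := by
    rintro _ ⟨⟨u, r⟩, rfl⟩
    exact add_mem (mem_tangentSubmodule.2 (hDp u)) (Submodule.smul_mem _ r hν)
  have hrange : L.range = tangentSubmodule p := by
    refine Submodule.eq_of_le_of_finrank_le hle ?_
    rw [LinearMap.finrank_range_of_inj hL, Module.finrank_prod, hdim, Module.finrank_self]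
    exact finrank_tangentSubmodule_le hp
  rw [← mem_tangentSubmodule, ← hrange, LinearMap.mem_range, Prod.exists]
  exact exists₂_congr fun u r => eq_comm

end Frame

/-! ### Parametrized hypersurfaces of the Grassmannian -/

theorem fderiv_fderiv_of_leftInverse {E W : Type*} [NormedAddCommGroup E] [NormedSpace ℝ E]
    [NormedAddCommGroup W] [NormedSpace ℝ W] {C : W → E} {F : E → W} (hC : Differentiable ℝ C)
    (hF : Differentiable ℝ F) (hCF : Function.LeftInverse C F) (t u : E) :
    fderiv ℝ C (F t) (fderiv ℝ F t u) = u := by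
  have hcomp := fderiv_comp t (hC (F t)) (hF t)
  rw [hCF.comp_eq_id, fderiv_id] at hcomp
  exact congrArg (fun L : E →L[ℝ] E => L u) hcomp.symm

section Parametrization

variable {n : ℕ} {E : Type*} [NormedAddCommGroup E] [NormedSpace ℝ E]

/-- `F` parametrizes a real hypersurface of the Grassmannian by a normed space, with unit normal
field `ν` along `F`. The smooth left inverse `C` of `F` makes `F` an embedding. -/
structure IsHypersurfaceParametrization (F ν : E → Mat n) (C : Mat n → E) : Prop where
  contDiff : ContDiff ℝ ∞ F
  contDiff_leftInverse : ContDiff ℝ ∞ C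
  leftInverse : Function.LeftInverse C F
  mem : ∀ t, F t ∈ grassmannian n
  contDiff_normal : ContDiff ℝ ∞ ν
  unit : ∀ t, metric (ν t) (ν t) = 1
  normal : ∀ t u, metric (fderiv ℝ F t u) (ν t) = 0
  isTangent_iff : ∀ t w, IsTangent (F t) w ↔ ∃ (u : E) (r : ℝ), w = fderiv ℝ F t u + r • ν t

/-- The metric that the parametrization `F` pulls back from the Grassmannian. -/
def inducedMetric (F : E → Mat n) (t : E) : E →L[ℝ] E →L[ℝ] ℝ :=
  (metricL n).bilinearComp (fderiv ℝ F t) (fderiv ℝ F t)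

/-- The vector field `ξ = -J ν`, in the parametrization `F` with left inverse `C`. -/
def inducedξ (F ν : E → Mat n) (C : Mat n → E) (t : E) : E :=
  fderiv ℝ C (F t) (-J (F t) (ν t))

/-- The `1`-form `η(u) = g(u, -J ν)`, in the parametrization `F`. -/
def inducedη (F ν : E → Mat n) (t : E) : E →L[ℝ] ℝ :=
  ((metricL n).flip (-J (F t) (ν t))).comp (fderiv ℝ F t)

/-- The endomorphism field `φ u = J u - η(u) ν`, in the parametrization `F` with left inverse
`C`. -/
def inducedφ (F ν : E → Mat n) (C : Mat n → E) (t : E) : E →L[ℝ] E :=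
  (fderiv ℝ C (F t)).comp
    ((JL n (F t)).comp (fderiv ℝ F t) - (inducedη F ν t).smulRight (ν t))

variable {F ν : E → Mat n} {C : Mat n → E}

theorem inducedMetric_apply (t u v : E) :
    inducedMetric F t u v = metric (fderiv ℝ F t u) (fderiv ℝ F t v) := rfl

theorem inducedη_apply (t u : E) :
    inducedη F ν t u = metric (fderiv ℝ F t u) (-J (F t) (ν t)) := rfl

theorem inducedη_eq_metric_J (t u : E) :
    inducedη F ν t u = metric (J (F t) (fderiv ℝ F t u)) (ν t) := by
  rw [inducedη_apply, metric_neg_right, metric_J_left]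

namespace IsHypersurfaceParametrization

variable (h : IsHypersurfaceParametrization F ν C)
include h

theorem differentiable : Differentiable ℝ F := h.contDiff.differentiable (by simp)

theorem contDiff_fderiv : ContDiff ℝ ∞ (fderiv ℝ F) := h.contDiff.fderiv_right (by simp)

theorem contDiff_fderiv_leftInverse : ContDiff ℝ ∞ fun t => fderiv ℝ C (F t) :=
  (h.contDiff_leftInverse.fderiv_right (by simp)).comp h.contDiff

theorem contDiff_neg_J_normal : ContDiff ℝ ∞ fun t => -J (F t) (ν t) :=
  (((JL n).contDiff.comp h.contDiff).clm_apply h.contDiff_normal).neg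

theorem contDiff_inducedMetric [FiniteDimensional ℝ E] : ContDiff ℝ ∞ (inducedMetric F) := by
  refine contDiff_clm_apply_iff.2 fun u => contDiff_clm_apply_iff.2 fun v => ?_
  have hF (w : E) : ContDiff ℝ ∞ fun t => fderiv ℝ F t w :=
    h.contDiff_fderiv.clm_apply contDiff_const
  exact ((metricL n).contDiff.comp (hF u)).clm_apply (hF v)

theorem contDiff_inducedξ : ContDiff ℝ ∞ (inducedξ F ν C) :=
  h.contDiff_fderiv_leftInverse.clm_apply h.contDiff_neg_J_normal

theorem contDiff_inducedη : ContDiff ℝ ∞ (inducedη F ν) :=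
  ((metricL n).flip.contDiff.comp h.contDiff_neg_J_normal).clm_comp h.contDiff_fderiv

theorem contDiff_inducedφ : ContDiff ℝ ∞ (inducedφ F ν C) := by
  refine h.contDiff_fderiv_leftInverse.clm_comp (ContDiff.sub ?_ ?_)
  · exact ((JL n).contDiff.comp h.contDiff).clm_comp h.contDiff_fderiv
  · exact h.contDiff_inducedη.smulRight h.contDiff_normal

theorem isTangent_fderiv (t u : E) : IsTangent (F t) (fderiv ℝ F t u) :=
  (h.isTangent_iff t _).2 ⟨u, 0, by simp⟩

theorem isTangent_normal (t : E) : IsTangent (F t) (ν t) :=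
  (h.isTangent_iff t _).2 ⟨0, 1, by simp⟩

theorem fderiv_leftInverse_fderiv (t u : E) : fderiv ℝ C (F t) (fderiv ℝ F t u) = u :=
  fderiv_fderiv_of_leftInverse (h.contDiff_leftInverse.differentiable (by simp)) h.differentiable
    h.leftInverse t u

theorem injective_fderiv (t : E) : Function.Injective (fderiv ℝ F t) :=
  Function.LeftInverse.injective (h.fderiv_leftInverse_fderiv t)

theorem fderiv_fderiv_leftInverse {t : E} {w : Mat n} (hw : IsTangent (F t) w)
    (hwν : metric w (ν t) = 0) : fderiv ℝ F t (fderiv ℝ C (F t) w) = w := by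
  obtain ⟨u, r, rfl⟩ := (h.isTangent_iff t w).1 hw
  have hr : r = 0 := by
    rwa [← sub_neg_eq_add, ← neg_smul, metric_sub_smul_left, h.normal, h.unit, mul_one, zero_sub,
      neg_neg] at hwν
  rw [hr, zero_smul, add_zero, h.fderiv_leftInverse_fderiv]

theorem fderiv_inducedξ (t : E) : fderiv ℝ F t (inducedξ F ν C t) = -J (F t) (ν t) := by
  refine h.fderiv_fderiv_leftInverse
    (neg_mem (mem_tangentSubmodule.2 (isTangent_J (h.mem t) (h.isTangent_normal t)))) ?_
  rw [metric_comm, metric_neg_right, metric_J_self, neg_zero]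

theorem fderiv_inducedφ (t u : E) : fderiv ℝ F t (inducedφ F ν C t u) =
    J (F t) (fderiv ℝ F t u) - inducedη F ν t u • ν t := by
  refine h.fderiv_fderiv_leftInverse (w := J (F t) (fderiv ℝ F t u) - inducedη F ν t u • ν t)
    (sub_mem (mem_tangentSubmodule.2 (isTangent_J (h.mem t) (h.isTangent_fderiv t u)))
      (Submodule.smul_mem _ _ (h.isTangent_normal t))) ?_
  rw [metric_sub_smul_left, h.unit, inducedη_eq_metric_J, mul_one, sub_self]

theorem inducedη_eq_inducedMetric (t u : E) :
    inducedη F ν t u = inducedMetric F t u (inducedξ F ν C t) := by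
  rw [inducedMetric_apply, h.fderiv_inducedξ, inducedη_apply]

theorem inducedMetric_pos (t u : E) (hu : u ≠ 0) : 0 < inducedMetric F t u u :=
  metric_self_pos (h.mem t) (h.isTangent_fderiv t u)
    ((map_ne_zero_iff _ (h.injective_fderiv t)).2 hu)

theorem inducedη_inducedξ (t : E) : inducedη F ν t (inducedξ F ν C t) = 1 := by
  rw [inducedη_eq_metric_J, h.fderiv_inducedξ, ← JL_apply, map_neg, JL_apply,
    J_J (h.mem t) (h.isTangent_normal t), neg_neg, h.unit]

theorem inducedη_inducedφ (t u : E) : inducedη F ν t (inducedφ F ν C t u) = 0 := by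
  rw [inducedη_eq_metric_J, h.fderiv_inducedφ, ← JL_apply, map_sub, map_smul, JL_apply, JL_apply,
    J_J (h.mem t) (h.isTangent_fderiv t u), metric_sub_smul_left, metric_comm, metric_neg_right,
    metric_comm, h.normal, metric_comm, metric_J_self, mul_zero, neg_zero, sub_zero]

theorem inducedφ_inducedφ (t u : E) : inducedφ F ν C t (inducedφ F ν C t u) =
    -u + inducedη F ν t u • inducedξ F ν C t := by
  apply h.injective_fderiv t
  rw [h.fderiv_inducedφ, h.inducedη_inducedφ, h.fderiv_inducedφ, ← JL_apply, map_sub, map_smul,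
    JL_apply, JL_apply, J_J (h.mem t) (h.isTangent_fderiv t u), map_add, map_neg, map_smul,
    h.fderiv_inducedξ, zero_smul, sub_zero, smul_neg, sub_eq_add_neg]

theorem inducedMetric_inducedφ_right (t u v : E) : inducedMetric F t u (inducedφ F ν C t v) =
    metric (fderiv ℝ F t u) (J (F t) (fderiv ℝ F t v)) := by
  rw [inducedMetric_apply, h.fderiv_inducedφ, metric_comm, metric_sub_smul_left, metric_comm (ν t),
    h.normal, mul_zero, sub_zero, metric_comm]

theorem inducedMetric_inducedφ_inducedφ (t u v : E) :
    inducedMetric F t (inducedφ F ν C t u) (inducedφ F ν C t v) =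
      inducedMetric F t u v - inducedη F ν t u * inducedη F ν t v := by
  rw [h.inducedMetric_inducedφ_right, h.fderiv_inducedφ, metric_sub_smul_left, metric_J_left,
    J_J (h.mem t) (h.isTangent_fderiv t v), metric_neg_right, neg_neg, metric_comm (ν t),
    ← inducedη_eq_metric_J, inducedMetric_apply]

variable {M : Type*} [TopologicalSpace M] [ChartedSpace E M] {e : M ≃ₜ E} (he : IsGlobalChart e)

include he

theorem isHypersurfaceWithUnitNormal :
    IsHypersurfaceWithUnitNormal 𝓘(ℝ, E) (F ∘ e) (ν ∘ e) where
  isEmbedding := (h.leftInverse.isEmbedding h.contDiff_leftInverse.continuous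
    h.contDiff.continuous).comp e.isEmbedding
  contMDiff := he.contMDiff_comp h.contDiff
  injective_mfderiv x := by
    rw [he.differential_comp h.differentiable]
    exact h.injective_fderiv (e x)
  mem x := h.mem (e x)
  contMDiff_normal := he.contMDiff_comp h.contDiff_normal
  isTangent_normal x := h.isTangent_normal (e x)
  unit x := h.unit (e x)
  normal x u := by
    rw [he.differential_comp h.differentiable]
    exact h.normal (e x) u
  codim_one x w := by
    rw [he.differential_comp h.differentiable]
    exact h.isTangent_iff (e x) w

variable [FiniteDimensional ℝ E] [IsManifold 𝓘(ℝ, E) ∞ M]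

/-- The almost contact metric structure induced on a hypersurface of the Grassmannian. -/
def almostContactMetricStructure : AlmostContactMetricStructure 𝓘(ℝ, E) M :=
  he.almostContactMetricStructure (inducedMetric F) (inducedξ F ν C) (inducedη F ν)
    (inducedφ F ν C) h.contDiff_inducedMetric h.contDiff_inducedξ h.contDiff_inducedη
    h.contDiff_inducedφ (fun _ _ _ => metric_comm _ _) h.inducedMetric_pos h.inducedη_inducedξ
    h.inducedφ_inducedφ h.inducedMetric_inducedφ_inducedφ

theorem isInducedStructure : IsInducedStructure 𝓘(ℝ, E) (F ∘ e) (ν ∘ e)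
    (h.almostContactMetricStructure he) where
  metric_eq x u v := by
    rw [he.differential_comp h.differentiable]
    rfl
  ξ_eq x := by
    rw [he.differential_comp h.differentiable]
    exact h.fderiv_inducedξ (e x)
  η_eq x u := h.inducedη_eq_inducedMetric (e x) u
  φ_eq x u := by
    rw [he.differential_comp h.differentiable]
    exact h.fderiv_inducedφ (e x) u

theorem isContactMetric (hdη : ∀ t u v, metric (fderiv ℝ F t u) (J (F t) (fderiv ℝ F t v)) =
      (1 / 2) * (fderiv ℝ (inducedη F ν) t u v - fderiv ℝ (inducedη F ν) t v u)) :
    (h.almostContactMetricStructure he).IsContactMetric := fun x X Y hX hY =>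
  ((h.inducedMetric_inducedφ_right (e x) (X x) (Y x)).trans (hdη (e x) (X x) (Y x))).trans
    (he.extDerivOneForm_eq h.contDiff_inducedη hX hY).symm

end IsHypersurfaceParametrization

end Parametrization

/-! ### Frames adapted to an isotropic vector -/

section AdaptedFrame

variable {n : ℕ} {E : Type*} [NormedAddCommGroup E] [NormedSpace ℝ E]

/-- Smooth orthonormal frames `f₁, f₂` of planes in the Grassmannian, normalized by an isotropic
vector `ℓ`. The hypersurfaces spanned by such frames carry contact metric structures. -/
structure IsAdaptedFrame (ℓ : Vec n) (f₁ f₂ : E → Vec n) : Prop where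
  form_null_null : form ℓ ℓ = 0
  contDiff_fst : ContDiff ℝ ∞ f₁
  contDiff_snd : ContDiff ℝ ∞ f₂
  isPositiveFrame : ∀ t, IsPositiveFrame (f₁ t) (f₂ t)
  form_fst_null : ∀ t, form (f₁ t) ℓ = 1
  form_snd_null : ∀ t, form (f₂ t) ℓ = 0

/-- The unit normal vector at the plane of the frame `x, y` adapted to `ℓ`: the plane moves by
rotating `x` away from `ℓ`. -/
def adaptedNormal (ℓ x y : Vec n) : Mat n := planeVelocity x y ((2 : ℝ) • (x - ℓ)) 0

theorem planeVelocity_add_smul_sub_smul (x y u v : Vec n) (r : ℝ) :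
    planeVelocity x y (u + r • y) (v - r • x) = planeVelocity x y u v := by
  simp [planeVelocity, wedge_self]

theorem form_fderiv_add_form_fderiv {f g : E → Vec n} {t : E} (hf : DifferentiableAt ℝ f t)
    (hg : DifferentiableAt ℝ g t) {r : ℝ} (hfg : ∀ t, form (f t) (g t) = r) (u : E) :
    form (f t) (fderiv ℝ g t u) + form (fderiv ℝ f t u) (g t) = 0 := by
  have hderiv := ((form (n := n)).hasFDerivAt.comp t hf.hasFDerivAt).clm_apply hg.hasFDerivAt
  have hconst : HasFDerivAt (fun t => form (f t) (g t)) (0 : E →L[ℝ] ℝ) t := by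
    simpa only [hfg] using hasFDerivAt_const r t
  exact congrArg (fun L : E →L[ℝ] ℝ => L u) (hderiv.unique hconst)

theorem contDiff_wedge : ContDiff ℝ ∞ (wedge (n := n)) := ContinuousLinearMap.contDiff _

namespace IsAdaptedFrame

variable {ℓ : Vec n} {f₁ f₂ : E → Vec n} (h : IsAdaptedFrame ℓ f₁ f₂)
include h

theorem comp {E' : Type*} [NormedAddCommGroup E'] [NormedSpace ℝ E'] {c : E' → E}
    (hc : ContDiff ℝ ∞ c) : IsAdaptedFrame ℓ (f₁ ∘ c) (f₂ ∘ c) where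
  form_null_null := h.form_null_null
  contDiff_fst := h.contDiff_fst.comp hc
  contDiff_snd := h.contDiff_snd.comp hc
  isPositiveFrame t := h.isPositiveFrame (c t)
  form_fst_null t := h.form_fst_null (c t)
  form_snd_null t := h.form_snd_null (c t)

theorem hasFDerivAt_fst (t : E) : HasFDerivAt f₁ (fderiv ℝ f₁ t) t :=
  (h.contDiff_fst.differentiable (by simp) t).hasFDerivAt

theorem hasFDerivAt_snd (t : E) : HasFDerivAt f₂ (fderiv ℝ f₂ t) t :=
  (h.contDiff_snd.differentiable (by simp) t).hasFDerivAt

theorem contDiff_wedge : ContDiff ℝ ∞ fun t => wedge (f₁ t) (f₂ t) :=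
  (LieHypersurface.contDiff_wedge.comp h.contDiff_fst).clm_apply h.contDiff_snd

theorem contDiff_adaptedNormal : ContDiff ℝ ∞ fun t => adaptedNormal ℓ (f₁ t) (f₂ t) := by
  simp only [adaptedNormal, planeVelocity, map_zero, add_zero]
  exact (LieHypersurface.contDiff_wedge.comp
    ((h.contDiff_fst.sub contDiff_const).const_smul (2 : ℝ))).clm_apply h.contDiff_snd

theorem fderiv_wedge (t u : E) : fderiv ℝ (fun t => wedge (f₁ t) (f₂ t)) t u =
    planeVelocity (f₁ t) (f₂ t) (fderiv ℝ f₁ t u) (fderiv ℝ f₂ t u) := by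
  have hderiv := ContinuousLinearMap.hasFDerivAt_of_bilinear (wedge (n := n))
    (h.hasFDerivAt_fst t) (h.hasFDerivAt_snd t)
  exact (congrArg (fun L : E →L[ℝ] Mat n => L u) hderiv.fderiv).trans (add_comm _ _)

theorem form_fst_fderiv_fst (t u : E) : form (f₁ t) (fderiv ℝ f₁ t u) = 0 := by
  have := form_fderiv_add_form_fderiv (h.hasFDerivAt_fst t).differentiableAt
    (h.hasFDerivAt_fst t).differentiableAt (fun t => (h.isPositiveFrame t).fst_fst) u
  rw [form_comm (fderiv ℝ f₁ t u)] at this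
  linarith

theorem form_snd_fderiv_snd (t u : E) : form (f₂ t) (fderiv ℝ f₂ t u) = 0 := by
  have := form_fderiv_add_form_fderiv (h.hasFDerivAt_snd t).differentiableAt
    (h.hasFDerivAt_snd t).differentiableAt (fun t => (h.isPositiveFrame t).snd_snd) u
  rw [form_comm (fderiv ℝ f₂ t u)] at this
  linarith

theorem form_snd_fderiv_fst (t u : E) :
    form (f₂ t) (fderiv ℝ f₁ t u) = -form (f₁ t) (fderiv ℝ f₂ t u) := by
  have := form_fderiv_add_form_fderiv (h.hasFDerivAt_fst t).differentiableAt
    (h.hasFDerivAt_snd t).differentiableAt (fun t => (h.isPositiveFrame t).fst_snd) u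
  rw [form_comm (fderiv ℝ f₁ t u)] at this
  linarith

theorem form_null_fderiv_fst (t u : E) : form ℓ (fderiv ℝ f₁ t u) = 0 := by
  simpa [form_comm ℓ] using form_fderiv_add_form_fderiv (h.hasFDerivAt_fst t).differentiableAt
    (differentiableAt_const ℓ) h.form_fst_null u

theorem form_null_fderiv_snd (t u : E) : form ℓ (fderiv ℝ f₂ t u) = 0 := by
  simpa [form_comm ℓ] using form_fderiv_add_form_fderiv (h.hasFDerivAt_snd t).differentiableAt
    (differentiableAt_const ℓ) h.form_snd_null u

theorem adaptedNormal_vector_mem_planePerp (t : E) :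
    (2 : ℝ) • (f₁ t - ℓ) ∈ planePerp (f₁ t) (f₂ t) := by
  have hyx : form (f₂ t) (f₁ t) = 0 := by rw [form_comm, (h.isPositiveFrame t).fst_snd]
  simp [mem_planePerp, (h.isPositiveFrame t).fst_fst, hyx, h.form_fst_null, h.form_snd_null]

theorem fderiv_fst_add_mem_planePerp (t u : E) :
    fderiv ℝ f₁ t u + form (f₁ t) (fderiv ℝ f₂ t u) • f₂ t ∈ planePerp (f₁ t) (f₂ t) := by
  simp [mem_planePerp, h.form_fst_fderiv_fst, h.form_snd_fderiv_fst, (h.isPositiveFrame t).fst_snd,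
    (h.isPositiveFrame t).snd_snd]

theorem fderiv_snd_sub_mem_planePerp (t u : E) :
    fderiv ℝ f₂ t u - form (f₁ t) (fderiv ℝ f₂ t u) • f₁ t ∈ planePerp (f₁ t) (f₂ t) := by
  simp [mem_planePerp, h.form_snd_fderiv_snd, (h.isPositiveFrame t).fst_fst,
    form_comm (f₂ t) (f₁ t), (h.isPositiveFrame t).fst_snd]

theorem fderiv_wedge_eq (t u : E) : fderiv ℝ (fun t => wedge (f₁ t) (f₂ t)) t u =
    planeVelocity (f₁ t) (f₂ t) (fderiv ℝ f₁ t u + form (f₁ t) (fderiv ℝ f₂ t u) • f₂ t)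
      (fderiv ℝ f₂ t u - form (f₁ t) (fderiv ℝ f₂ t u) • f₁ t) := by
  rw [h.fderiv_wedge, planeVelocity_add_smul_sub_smul]

theorem isTangent_fderiv_wedge (t u : E) :
    IsTangent (wedge (f₁ t) (f₂ t)) (fderiv ℝ (fun t => wedge (f₁ t) (f₂ t)) t u) :=
  (h.isPositiveFrame t).isTangent_wedge_iff.2 ⟨_, h.fderiv_fst_add_mem_planePerp t u, _,
    h.fderiv_snd_sub_mem_planePerp t u, h.fderiv_wedge_eq t u⟩

theorem isTangent_adaptedNormal (t : E) :
    IsTangent (wedge (f₁ t) (f₂ t)) (adaptedNormal ℓ (f₁ t) (f₂ t)) :=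
  (h.isPositiveFrame t).isTangent_wedge_iff.2
    ⟨_, h.adaptedNormal_vector_mem_planePerp t, 0, zero_mem _, rfl⟩

theorem metric_adaptedNormal_self (t : E) :
    metric (adaptedNormal ℓ (f₁ t) (f₂ t)) (adaptedNormal ℓ (f₁ t) (f₂ t)) = 1 := by
  have hmem := h.adaptedNormal_vector_mem_planePerp t
  rw [adaptedNormal, (h.isPositiveFrame t).metric_planeVelocity hmem (zero_mem _) hmem
    (zero_mem _)]
  simp only [map_smul, map_sub, _root_.smul_apply, _root_.sub_apply,
    (h.isPositiveFrame t).fst_fst, form_comm ℓ (f₁ t), h.form_fst_null, h.form_null_null,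
    smul_eq_mul, map_zero]
  norm_num

theorem metric_fderiv_wedge_adaptedNormal (t u : E) :
    metric (fderiv ℝ (fun t => wedge (f₁ t) (f₂ t)) t u) (adaptedNormal ℓ (f₁ t) (f₂ t)) = 0 := by
  rw [h.fderiv_wedge_eq, adaptedNormal, (h.isPositiveFrame t).metric_planeVelocity
    (h.fderiv_fst_add_mem_planePerp t u) (h.fderiv_snd_sub_mem_planePerp t u)
    (h.adaptedNormal_vector_mem_planePerp t) (zero_mem _), form_comm]
  simp [form_comm ℓ (f₂ t), h.form_fst_fderiv_fst, h.form_null_fderiv_fst, h.form_snd_null,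
    (h.isPositiveFrame t).fst_snd]

theorem inducedη_eq (t : E) :
    inducedη (fun t => wedge (f₁ t) (f₂ t)) (fun t => adaptedNormal ℓ (f₁ t) (f₂ t)) t =
      (-(1 / 2) : ℝ) • (form (f₁ t)).comp (fderiv ℝ f₂ t) := by
  ext u
  have hJ : -J (wedge (f₁ t) (f₂ t)) (adaptedNormal ℓ (f₁ t) (f₂ t)) =
      planeVelocity (f₁ t) (f₂ t) 0 ((2 : ℝ) • (f₁ t - ℓ)) := by
    rw [adaptedNormal, (h.isPositiveFrame t).J_planeVelocity
      (h.adaptedNormal_vector_mem_planePerp t) (zero_mem _)]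
    simp [planeVelocity]
  rw [inducedη_apply, hJ, h.fderiv_wedge_eq, (h.isPositiveFrame t).metric_planeVelocity
    (h.fderiv_fst_add_mem_planePerp t u) (h.fderiv_snd_sub_mem_planePerp t u) (zero_mem _)
    (h.adaptedNormal_vector_mem_planePerp t), form_comm (_ - _)]
  simp only [map_add, map_smul, map_sub, map_zero, _root_.smul_apply, _root_.sub_apply,
    (h.isPositiveFrame t).fst_fst, form_comm ℓ (f₁ t), h.form_fst_null, h.form_null_fderiv_snd,
    smul_eq_mul, ContinuousLinearMap.comp_apply]
  ring

theorem metric_fderiv_wedge_J (t u v : E) :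
    metric (fderiv ℝ (fun t => wedge (f₁ t) (f₂ t)) t u)
        (J (wedge (f₁ t) (f₂ t)) (fderiv ℝ (fun t => wedge (f₁ t) (f₂ t)) t v)) =
      (1 / 4) * (form (fderiv ℝ f₂ t u) (fderiv ℝ f₁ t v) -
        form (fderiv ℝ f₁ t u) (fderiv ℝ f₂ t v)) := by
  have hu := h.fderiv_fst_add_mem_planePerp t u
  have hu' := h.fderiv_snd_sub_mem_planePerp t u
  have hv := h.fderiv_fst_add_mem_planePerp t v
  have hv' := h.fderiv_snd_sub_mem_planePerp t v
  rw [h.fderiv_wedge_eq, h.fderiv_wedge_eq, (h.isPositiveFrame t).J_planeVelocity hv hv',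
    (h.isPositiveFrame t).metric_planeVelocity hu hu' hv' (neg_mem hv)]
  simp only [map_add, map_sub, map_neg, map_smul, _root_.add_apply, _root_.sub_apply,
    _root_.smul_apply, smul_eq_mul, h.form_fst_fderiv_fst,
    h.form_snd_fderiv_snd, form_comm (f₂ t) (f₁ t), form_comm (fderiv ℝ f₁ t u) (f₁ t),
    form_comm (fderiv ℝ f₂ t u) (f₂ t), (h.isPositiveFrame t).fst_snd]
  ring

theorem fderiv_inducedη (t u v : E) :
    fderiv ℝ (inducedη (fun t => wedge (f₁ t) (f₂ t))
        fun t => adaptedNormal ℓ (f₁ t) (f₂ t)) t u v =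
      -(1 / 2) * (form (f₁ t) (fderiv ℝ (fderiv ℝ f₂) t u v) +
        form (fderiv ℝ f₁ t u) (fderiv ℝ f₂ t v)) := by
  have hderiv : HasFDerivAt (fderiv ℝ f₂) (fderiv ℝ (fderiv ℝ f₂) t) t :=
    ((h.contDiff_snd.fderiv_right (m := ∞) (by simp)).differentiable (by simp) t).hasFDerivAt
  have hη : HasFDerivAt (fun t => (-(1 / 2) : ℝ) • (form (f₁ t)).comp (fderiv ℝ f₂ t)) _ t :=
    (((form (n := n)).hasFDerivAt.comp t (h.hasFDerivAt_fst t)).clm_comp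
      hderiv).const_smul (-(1 / 2) : ℝ)
  rw [funext h.inducedη_eq, HasFDerivAt.fderiv hη]
  rfl

theorem metric_fderiv_wedge_J_eq (t u v : E) :
    metric (fderiv ℝ (fun t => wedge (f₁ t) (f₂ t)) t u)
        (J (wedge (f₁ t) (f₂ t)) (fderiv ℝ (fun t => wedge (f₁ t) (f₂ t)) t v)) =
      (1 / 2) * (fderiv ℝ (inducedη (fun t => wedge (f₁ t) (f₂ t))
          fun t => adaptedNormal ℓ (f₁ t) (f₂ t)) t u v -
        fderiv ℝ (inducedη (fun t => wedge (f₁ t) (f₂ t))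
          fun t => adaptedNormal ℓ (f₁ t) (f₂ t)) t v u) := by
  have hsymm := h.contDiff_snd.contDiffAt.isSymmSndFDerivAt (x := t)
    (by rw [minSmoothness_of_isRCLikeNormedField]; exact ENat.LEInfty.out)
  rw [h.metric_fderiv_wedge_J, h.fderiv_inducedη, h.fderiv_inducedη, hsymm.eq u v,
    form_comm (fderiv ℝ f₂ t u)]
  ring

theorem wedge_mulVec_null (t : E) : wedge (f₁ t) (f₂ t) *ᵥ ℓ = -f₂ t := by
  simp [wedge_mulVec, h.form_fst_null, h.form_snd_null]

theorem wedge_mulVec_wedge_mulVec_null (t : E) :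
    wedge (f₁ t) (f₂ t) *ᵥ (wedge (f₁ t) (f₂ t) *ᵥ ℓ) = -f₁ t := by
  have hpos := h.isPositiveFrame t
  simp [h.wedge_mulVec_null, wedge_mulVec, hpos.fst_snd, hpos.snd_snd]

theorem isHypersurfaceParametrization [FiniteDimensional ℝ E]
    (hdim : Module.finrank ℝ E = 2 * (n - 1) + 3)
    (hmem : ∀ t, wedge (f₁ t) (f₂ t) ∈ grassmannian n) {C : Mat n → E} (hC : ContDiff ℝ ∞ C)
    (hCf : Function.LeftInverse C fun t => wedge (f₁ t) (f₂ t)) :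
    IsHypersurfaceParametrization (fun t => wedge (f₁ t) (f₂ t))
      (fun t => adaptedNormal ℓ (f₁ t) (f₂ t)) C where
  contDiff := h.contDiff_wedge
  contDiff_leftInverse := hC
  leftInverse := hCf
  mem := hmem
  contDiff_normal := h.contDiff_adaptedNormal
  unit := h.metric_adaptedNormal_self
  normal := h.metric_fderiv_wedge_adaptedNormal
  isTangent_iff t _ := isTangent_iff_of_finrank (hmem t) hdim
    (D := (fderiv ℝ (fun t => wedge (f₁ t) (f₂ t)) t).toLinearMap)
    (Function.LeftInverse.injective <| fderiv_fderiv_of_leftInverse (hC.differentiable (by simp))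
      (h.contDiff_wedge.differentiable (by simp)) hCf t)
    (h.isTangent_fderiv_wedge t) (h.isTangent_adaptedNormal t) (h.metric_adaptedNormal_self t)
    (h.metric_fderiv_wedge_adaptedNormal t)

end IsAdaptedFrame

end AdaptedFrame

local notation "e₃" => vec 0 0 1 0 0
local notation "e₄" => vec 0 0 0 1 0
local notation "ℓ₁" => vec 1 0 1 0 0
local notation "ℓ₂" => vec 0 1 0 1 0

/-! ### The Lie algebra `𝔰_N` -/

section LieAlgebra

variable {n : ℕ}

theorem A₁_eq_wedge : A₁ n = (c₀ / 2) • (wedge e₂ e₄ - wedge e₁ e₃) := by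
  refine mat_ext_mulVec fun v => ?_
  obtain ⟨a, b, c, d, f, rfl⟩ := exists_eq_vec v
  simp only [A₁, smul_mulVec, sub_mulVec, block_mulVec, wedge_mulVec, form_vec, smul_vec, vec_sub]
  simp

theorem A₂_eq_wedge : A₂ n = -(c₀ / 2) • (wedge e₂ e₄ + wedge e₁ e₃) := by
  refine mat_ext_mulVec fun v => ?_
  obtain ⟨a, b, c, d, f, rfl⟩ := exists_eq_vec v
  simp only [A₂, smul_mulVec, add_mulVec, block_mulVec, wedge_mulVec, form_vec, smul_vec, vec_sub,
    vec_add]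
  simp

theorem N_eq_wedge : N n = (2 : ℝ) • wedge e₁ e₃ := by
  have hc : 1 / √2 * c₀ = 2 := by rw [c₀]; field_simp
  rw [N, A₁_eq_wedge, A₂_eq_wedge]
  linear_combination (norm := module) hc • wedge (n := n) e₁ e₃

theorem X₀_eq_wedge : X₀ n = (c₀ / 2) • wedge (e₄ - e₂) ℓ₁ := by
  refine mat_ext_mulVec fun v => ?_
  obtain ⟨a, b, c, d, f, rfl⟩ := exists_eq_vec v
  simp only [X₀, smul_mulVec, block_mulVec, wedge_mulVec, form_vec, smul_vec, vec_sub]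
  simp [U, V, sub_eq_add_neg, add_comm]

theorem W₀_eq_wedge : W₀ n = (c₀ / 2) • wedge ℓ₂ ℓ₁ := by
  refine mat_ext_mulVec fun v => ?_
  obtain ⟨a, b, c, d, f, rfl⟩ := exists_eq_vec v
  simp only [W₀, smul_mulVec, block_mulVec, wedge_mulVec, form_vec, smul_vec, vec_sub]
  simp [U, sub_eq_add_neg, add_comm]

theorem shortRoot_mulVec (k : Fin 2) (i : Fin (n - 1)) (a b c d : ℝ) (f : Fin (n - 1) → ℝ) :
    shortRoot n k i *ᵥ vec a b c d f =
      (2 : ℝ) • vec (if k = 0 then f i else 0) (if k = 1 then f i else 0)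
        (if k = 0 then f i else 0) (if k = 1 then f i else 0)
        (Pi.single i (if k = 0 then a - c else b - d)) := by
  have hc : c₀ / √2 = 2 := by rw [c₀]; field_simp
  rw [shortRoot, hc, smul_mulVec]
  congr 1
  ext (j | j | j)
  · fin_cases j <;> fin_cases k <;>
      simp [vec, mulVec, dotProduct, Matrix.single, Finset.sum_ite_eq]
  · fin_cases j <;> fin_cases k <;>
      simp [vec, mulVec, dotProduct, Matrix.single, Finset.sum_ite_eq]
  · obtain rfl | hij := eq_or_ne i j
    · fin_cases k <;> simp [vec, mulVec, dotProduct, Matrix.single, sub_eq_add_neg]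
    · fin_cases k <;> simp [vec, mulVec, dotProduct, Matrix.single, hij, hij.symm]

theorem shortRoot_zero_eq_wedge (i : Fin (n - 1)) :
    shortRoot n 0 i = (2 : ℝ) • wedge (vec 0 0 0 0 (Pi.single i 1)) ℓ₁ := by
  refine mat_ext_mulVec fun v => ?_
  obtain ⟨a, b, c, d, f, rfl⟩ := exists_eq_vec v
  rw [shortRoot_mulVec, smul_mulVec, wedge_mulVec, form_vec, form_vec, smul_vec _ 0, smul_vec _ 1,
    vec_sub]
  simp [← Pi.single_smul]

theorem shortRoot_one_eq_wedge (i : Fin (n - 1)) :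
    shortRoot n 1 i = (2 : ℝ) • wedge (vec 0 0 0 0 (Pi.single i 1)) ℓ₂ := by
  refine mat_ext_mulVec fun v => ?_
  obtain ⟨a, b, c, d, f, rfl⟩ := exists_eq_vec v
  rw [shortRoot_mulVec, smul_mulVec, wedge_mulVec, form_vec, form_vec, smul_vec _ 0 0,
    smul_vec _ 0 1, vec_sub]
  simp [← Pi.single_smul]

/-- The elements of `𝔰𝔬(2, n + 1)` that preserve the flag `ℝ ℓ₁ ⊆ ℝ ℓ₁ ⊕ ℝ ℓ₂` of isotropic
subspaces and map the last `n - 1` coordinate vectors into it. -/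
def flagAlgebra (n : ℕ) : Submodule ℝ (Mat n) where
  carrier := {X | X ∈ so n ∧ X *ᵥ ℓ₁ ∈ Submodule.span ℝ {ℓ₁} ∧
    X *ᵥ ℓ₂ ∈ Submodule.span ℝ {ℓ₁, ℓ₂} ∧
    ∀ f, X *ᵥ vec 0 0 0 0 f ∈ Submodule.span ℝ {ℓ₁, ℓ₂}}
  zero_mem' := by simp
  add_mem' := by
    rintro X Y ⟨hX, hX₁, hX₂, hXf⟩ ⟨hY, hY₁, hY₂, hYf⟩
    simp only [Set.mem_ofPred_eq, add_mulVec]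
    exact ⟨add_mem hX hY, add_mem hX₁ hY₁, add_mem hX₂ hY₂, fun f => add_mem (hXf f) (hYf f)⟩
  smul_mem' := by
    rintro r X ⟨hX, hX₁, hX₂, hXf⟩
    simp only [Set.mem_ofPred_eq, smul_mulVec]
    exact ⟨Submodule.smul_mem _ r hX, Submodule.smul_mem _ r hX₁, Submodule.smul_mem _ r hX₂,
      fun f => Submodule.smul_mem _ r (hXf f)⟩

theorem mem_span_null_pair {x y : ℝ} {v : Vec n} (hv : v = x • ℓ₁ + y • ℓ₂) :
    v ∈ Submodule.span ℝ {ℓ₁, ℓ₂} :=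
  Submodule.mem_span_pair.2 ⟨x, y, hv.symm⟩

theorem wedge_null_fst_mem_flagAlgebra {b d : ℝ} {g : Fin (n - 1) → ℝ} :
    wedge (vec 0 b 0 d g) ℓ₁ ∈ flagAlgebra n := by
  refine ⟨wedge_mem_so _ _, Submodule.mem_span_singleton.2 ⟨0, ?_⟩,
    mem_span_null_pair (x := d - b) (y := 0) ?_,
    fun f => mem_span_null_pair (x := g ⬝ᵥ f) (y := 0) ?_⟩ <;>
  · simp [wedge_mulVec, form_vec, ← neg_smul]

theorem wedge_null_snd_mem_flagAlgebra {g : Fin (n - 1) → ℝ} :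
    wedge (vec 0 0 0 0 g) ℓ₂ ∈ flagAlgebra n := by
  refine ⟨wedge_mem_so _ _, Submodule.mem_span_singleton.2 ⟨0, ?_⟩,
    mem_span_null_pair (x := 0) (y := 0) ?_,
    fun f => mem_span_null_pair (x := 0) (y := g ⬝ᵥ f) ?_⟩ <;>
  · simp [wedge_mulVec, form_vec]

theorem wedge_e₁_e₃_mem_flagAlgebra : wedge e₁ e₃ ∈ flagAlgebra n := by
  refine ⟨wedge_mem_so _ _, Submodule.mem_span_singleton.2 ⟨-1, ?_⟩,
    mem_span_null_pair (x := 0) (y := 0) ?_,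
    fun f => mem_span_null_pair (x := 0) (y := 0) ?_⟩ <;>
  · simp only [wedge_mulVec, form_vec, smul_vec, vec_sub, vec_add]
    simp

theorem wedge_e₂_e₄_mem_flagAlgebra : wedge e₂ e₄ ∈ flagAlgebra n := by
  refine ⟨wedge_mem_so _ _, Submodule.mem_span_singleton.2 ⟨0, ?_⟩,
    mem_span_null_pair (x := 0) (y := -1) ?_,
    fun f => mem_span_null_pair (x := 0) (y := 0) ?_⟩ <;>
  · simp only [wedge_mulVec, form_vec, smul_vec, vec_sub, vec_add]
    simp

theorem solvablePart_le_flagAlgebra : solvablePart n ≤ flagAlgebra n := by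
  rw [solvablePart, Submodule.span_le]
  rintro X ((hX | ⟨i, rfl⟩) | ⟨i, rfl⟩)
  · simp only [Set.mem_insert_iff, Set.mem_singleton_iff] at hX
    obtain rfl | rfl | rfl | rfl := hX
    · rw [A₁_eq_wedge]
      exact Submodule.smul_mem _ _
        (sub_mem wedge_e₂_e₄_mem_flagAlgebra wedge_e₁_e₃_mem_flagAlgebra)
    · rw [A₂_eq_wedge]
      exact Submodule.smul_mem _ _
        (add_mem wedge_e₂_e₄_mem_flagAlgebra wedge_e₁_e₃_mem_flagAlgebra)
    · rw [X₀_eq_wedge, vec_sub, sub_self, sub_self]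
      exact Submodule.smul_mem _ _ wedge_null_fst_mem_flagAlgebra
    · rw [W₀_eq_wedge]
      exact Submodule.smul_mem _ _ wedge_null_fst_mem_flagAlgebra
  · rw [shortRoot_zero_eq_wedge]
    exact Submodule.smul_mem _ _ wedge_null_fst_mem_flagAlgebra
  · rw [shortRoot_one_eq_wedge]
    exact Submodule.smul_mem _ _ wedge_null_snd_mem_flagAlgebra

theorem velocity_N_Z : velocity (N n) (Z n) = (2 : ℝ) • wedge e₂ e₃ := by
  have he₁ : N n *ᵥ e₁ = -(2 : ℝ) • e₃ := by
    simp [N_eq_wedge, smul_mulVec, wedge_mulVec, form_vec]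
  have he₂ : N n *ᵥ e₂ = 0 := by
    simp [N_eq_wedge, smul_mulVec, wedge_mulVec, form_vec]
  have hN : N n ∈ so n := N_eq_wedge (n := n) ▸ Submodule.smul_mem _ _ (wedge_mem_so _ _)
  rw [Z_eq_wedge, velocity_wedge hN, he₁, he₂, map_zero, add_zero, map_smul, _root_.smul_apply,
    wedge_swap, smul_neg, neg_smul, neg_neg]

theorem modelInner_N {X : Mat n} (hX : X ∈ so n) :
    modelInner X (N n) = (1 / 2) * form (X *ᵥ ℓ₁) e₃ := by
  have he₃ : form (X *ᵥ e₃) e₃ = 0 := by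
    linarith [mem_so_iff.1 hX e₃ e₃, form_comm e₃ (X *ᵥ e₃)]
  have hℓ₁ : (ℓ₁ : Vec n) = e₁ + e₃ := by simp [vec_add]
  rw [modelInner, metric, velocity_N_Z, Z_eq_wedge, velocity_wedge hX, mul_smul_comm, trace_smul,
    trace_mul_wedge, c₀_sq, hℓ₁, mulVec_add, map_add, _root_.add_apply, he₃]
  simp only [add_mulVec, wedge_mulVec, map_add, map_sub, map_smul, smul_eq_mul, form_vec,
    zero_dotProduct, form_comm (X *ᵥ e₁) e₃]
  ring

theorem mem_sN_iff {X : Mat n} : X ∈ sN n ↔ X ∈ solvablePart n ∧ X *ᵥ ℓ₁ = 0 := by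
  refine and_congr_right fun hX => ?_
  obtain ⟨hso, hℓ₁, -⟩ := solvablePart_le_flagAlgebra hX
  obtain ⟨r, hr⟩ := Submodule.mem_span_singleton.1 hℓ₁
  rw [modelInner_N hso, ← hr, smul_vec, form_vec, ← vec_zero, vec_eq_vec_iff]
  simp

theorem sN_le_so : sN n ≤ so n := fun _ hX => (solvablePart_le_flagAlgebra hX.1).1

theorem wedge_e₂_e₄_mem_sN : wedge e₂ e₄ ∈ sN n := by
  have hc : c₀ ≠ 0 := by rw [c₀]; positivity
  have hA : wedge (n := n) e₂ e₄ = c₀⁻¹ • (A₁ n - A₂ n) := by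
    rw [A₁_eq_wedge, A₂_eq_wedge]
    linear_combination (norm := module) -(inv_mul_cancel₀ hc) • wedge (n := n) e₂ e₄
  refine mem_sN_iff.2 ⟨?_, by simp [wedge_mulVec, form_vec]⟩
  rw [hA]
  exact Submodule.smul_mem _ _ (sub_mem (Submodule.subset_span (by simp))
    (Submodule.subset_span (by simp)))

theorem vec_last_mem {W : Submodule ℝ (Vec n)} (hW : ∀ i, vec 0 0 0 0 (Pi.single i 1) ∈ W)
    (f : Fin (n - 1) → ℝ) : vec 0 0 0 0 f ∈ W := by
  have hf : (vec 0 0 0 0 f : Vec n) = ∑ i, f i • vec 0 0 0 0 (Pi.single i 1) := by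
    ext (j | j | j)
    · fin_cases j <;> simp [vec]
    · fin_cases j <;> simp [vec]
    · simp [vec, Pi.single_apply]
  rw [hf]
  exact W.sum_mem fun i _ => W.smul_mem _ (hW i)

theorem wedge_null_snd_mem_sN (g : Fin (n - 1) → ℝ) : wedge (vec 0 0 0 0 g) ℓ₂ ∈ sN n := by
  have hroot (i : Fin (n - 1)) : wedge (vec 0 0 0 0 (Pi.single i 1)) ℓ₂ ∈ solvablePart n := by
    rw [← Submodule.smul_mem_iff _ (two_ne_zero (α := ℝ)), ← shortRoot_one_eq_wedge]
    exact Submodule.subset_span (.inr ⟨i, rfl⟩)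
  let W : Submodule ℝ (Vec n) := (solvablePart n).comap (wedge.flip ℓ₂).toLinearMap
  exact mem_sN_iff.2 ⟨vec_last_mem (W := W) hroot g, by simp [wedge_mulVec, form_vec]⟩

theorem wedge_null_fst_mem_sN (b d : ℝ) (g : Fin (n - 1) → ℝ) :
    wedge (vec 0 b 0 d g) ℓ₁ ∈ sN n := by
  have hc : c₀ / 2 ≠ 0 := by rw [c₀]; positivity
  have hX₀ : wedge (e₄ - e₂) ℓ₁ ∈ solvablePart n := by
    rw [← Submodule.smul_mem_iff _ hc, ← X₀_eq_wedge]
    exact Submodule.subset_span (by simp)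
  have hW₀ : wedge ℓ₂ ℓ₁ ∈ solvablePart n := by
    rw [← Submodule.smul_mem_iff _ hc, ← W₀_eq_wedge]
    exact Submodule.subset_span (by simp)
  have hroot (i : Fin (n - 1)) : wedge (vec 0 0 0 0 (Pi.single i 1)) ℓ₁ ∈ solvablePart n := by
    rw [← Submodule.smul_mem_iff _ (two_ne_zero (α := ℝ)), ← shortRoot_zero_eq_wedge]
    exact Submodule.subset_span (.inl (.inr ⟨i, rfl⟩))
  let W : Submodule ℝ (Vec n) := (solvablePart n).comap (wedge.flip ℓ₁).toLinearMap
  have hv : (vec 0 b 0 d g : Vec n) =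
      ((d - b) / 2) • (e₄ - e₂) + ((b + d) / 2) • ℓ₂ + vec 0 0 0 0 g := by
    rw [vec_sub, smul_vec, smul_vec, vec_add, vec_add, vec_eq_vec_iff]
    refine ⟨by simp, by ring, by simp, by ring, by simp⟩
  have hmem : vec 0 b 0 d g ∈ W := hv ▸
    W.add_mem (W.add_mem (W.smul_mem _ hX₀) (W.smul_mem _ hW₀)) (vec_last_mem hroot g)
  exact mem_sN_iff.2 ⟨hmem, by simp [wedge_mulVec, form_vec]⟩

end LieAlgebra

/-! ### The group `S_N` -/

section Group

variable {n : ℕ}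

theorem connectedLieSubgroup_mono {𝔤 𝔥 : Submodule ℝ (Mat n)} (h : 𝔤 ≤ 𝔥) :
    connectedLieSubgroup 𝔤 ≤ connectedLieSubgroup 𝔥 :=
  Subgroup.closure_mono fun _ ⟨X, hX, ha⟩ => ⟨X, h hX, ha⟩

theorem expGL_mem_connectedLieSubgroup {𝔥 : Submodule ℝ (Mat n)} {X : Mat n} (hX : X ∈ 𝔥) :
    expGL X ∈ connectedLieSubgroup 𝔥 :=
  Subgroup.subset_closure ⟨X, hX, coe_expGL X⟩

theorem connectedLieSubgroup_induction {𝔥 : Submodule ℝ (Mat n)} {P : Mat n → Prop}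
    (hexp : ∀ X ∈ 𝔥, P (NormedSpace.exp X)) (hmul : ∀ a b, P a → P b → P (a * b))
    {a : GL (Idx n) ℝ} (ha : a ∈ connectedLieSubgroup 𝔥) : P a := by
  induction ha using Subgroup.closure_induction'' with
  | mem a ha =>
    obtain ⟨X, hX, ha⟩ := ha
    exact ha ▸ hexp X hX
  | inv_mem a ha =>
    obtain ⟨X, hX, ha⟩ := ha
    obtain rfl : a = expGL X := Units.ext ha
    exact hexp (-X) (neg_mem hX)
  | one => simpa using hexp 0 (zero_mem _)
  | mul a b _ _ hPa hPb => exact hmul a b hPa hPb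

theorem exists_mulVec_sub_mem_of_mem_connectedLieSubgroup {𝔥 : Submodule ℝ (Mat n)}
    {W : Submodule ℝ (Vec n)} (hW : ∀ X ∈ 𝔥, ∀ w ∈ W, X *ᵥ w ∈ W) {R : AddSubmonoid ℝ} {v : Vec n}
    (hv : ∀ X ∈ 𝔥, ∃ ρ ∈ R, X *ᵥ v - ρ • v ∈ W) {a : GL (Idx n) ℝ}
    (ha : a ∈ connectedLieSubgroup 𝔥) : ∃ ρ ∈ R, (a : Mat n) *ᵥ v - Real.exp ρ • v ∈ W := by
  let P (b : Mat n) : Prop := (∀ w ∈ W, b *ᵥ w ∈ W) ∧ ∃ ρ ∈ R, b *ᵥ v - Real.exp ρ • v ∈ W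
  have hexp (X) (hX : X ∈ 𝔥) : P (NormedSpace.exp X) := by
    refine ⟨fun w hw => ?_, (hv X hX).imp fun ρ hρ => ⟨hρ.1, exp_mulVec_sub_mem (hW X hX) hρ.2⟩⟩
    have hsub := exp_mulVec_sub_mem (ρ := 0) (hW X hX) (by simpa using hW X hX w hw)
    exact (W.sub_mem_iff_left (W.smul_mem _ hw)).1 hsub
  have hmul (a b) (hPa : P a) (hPb : P b) : P (a * b) := by
    obtain ⟨hWa, ρ, hρ, hva⟩ := hPa
    obtain ⟨hWb, σ, hσ, hvb⟩ := hPb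
    have hab : (a * b) *ᵥ v - Real.exp (ρ + σ) • v =
        a *ᵥ (b *ᵥ v - Real.exp σ • v) + Real.exp σ • (a *ᵥ v - Real.exp ρ • v) := by
      rw [← mulVec_mulVec, mulVec_sub, mulVec_smul, smul_sub, smul_smul, Real.exp_add, mul_comm]
      abel
    refine ⟨fun w hw => by simpa using hWa _ (hWb w hw), ρ + σ, R.add_mem hρ hσ, ?_⟩
    rw [hab]
    exact W.add_mem (hWa _ hvb) (W.smul_mem _ hva)
  exact (connectedLieSubgroup_induction hexp hmul ha).2

variable {a b : GL (Idx n) ℝ}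

theorem SN_le_SO₀ : SN n ≤ SO₀ n := connectedLieSubgroup_mono sN_le_so

theorem SN_le_isometryGroup : SN n ≤ isometryGroup n := SN_le_SO₀.trans SO₀_le_isometryGroup

theorem SN_mulVec_null_fst (ha : a ∈ SN n) : (a : Mat n) *ᵥ ℓ₁ = ℓ₁ := by
  obtain ⟨ρ, rfl, hρ⟩ := exists_mulVec_sub_mem_of_mem_connectedLieSubgroup (W := ⊥) (R := ⊥)
    (v := ℓ₁) (by simp) (fun X hX => ⟨0, rfl, by simp [(mem_sN_iff.1 hX).2]⟩) ha
  simpa [sub_eq_zero] using hρ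

theorem exists_SN_mulVec_null_snd (ha : a ∈ SN n) :
    ∃ ρ x : ℝ, (a : Mat n) *ᵥ ℓ₂ = Real.exp ρ • ℓ₂ + x • ℓ₁ := by
  have hW : ∀ X ∈ sN n, ∀ w ∈ Submodule.span ℝ {ℓ₁}, X *ᵥ w ∈ Submodule.span ℝ {ℓ₁} := by
    intro X hX w hw
    obtain ⟨r, rfl⟩ := Submodule.mem_span_singleton.1 hw
    simp [mulVec_smul, (mem_sN_iff.1 hX).2]
  have hv : ∀ X ∈ sN n, ∃ ρ ∈ (⊤ : AddSubmonoid ℝ), X *ᵥ ℓ₂ - ρ • ℓ₂ ∈ Submodule.span ℝ {ℓ₁} := by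
    intro X hX
    obtain ⟨-, -, hX₂, -⟩ := solvablePart_le_flagAlgebra hX.1
    obtain ⟨x, y, hxy⟩ := Submodule.mem_span_pair.1 hX₂
    exact ⟨y, trivial, Submodule.mem_span_singleton.2 ⟨x, by simp [← hxy]⟩⟩
  obtain ⟨ρ, -, hρ⟩ := exists_mulVec_sub_mem_of_mem_connectedLieSubgroup hW hv ha
  obtain ⟨x, hx⟩ := Submodule.mem_span_singleton.1 hρ
  exact ⟨ρ, x, by rw [hx, add_sub_cancel]⟩

theorem SN_mulVec_last_sub_mem (ha : a ∈ SN n) (f : Fin (n - 1) → ℝ) :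
    (a : Mat n) *ᵥ vec 0 0 0 0 f - vec 0 0 0 0 f ∈ Submodule.span ℝ {ℓ₁, ℓ₂} := by
  have hW : ∀ X ∈ sN n, ∀ w ∈ Submodule.span ℝ {ℓ₁, ℓ₂}, X *ᵥ w ∈ Submodule.span ℝ {ℓ₁, ℓ₂} := by
    intro X hX w hw
    obtain ⟨x, y, rfl⟩ := Submodule.mem_span_pair.1 hw
    rw [mulVec_add, mulVec_smul, mulVec_smul, (mem_sN_iff.1 hX).2, smul_zero, zero_add]
    exact Submodule.smul_mem _ y (solvablePart_le_flagAlgebra hX.1).2.2.1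
  obtain ⟨ρ, rfl, hρ⟩ := exists_mulVec_sub_mem_of_mem_connectedLieSubgroup (R := ⊥)
    (v := vec 0 0 0 0 f) hW
    (fun X hX => ⟨0, rfl, by simpa using (solvablePart_le_flagAlgebra hX.1).2.2.2 f⟩) ha
  simpa using hρ

theorem eq_zero_of_mem_span_null_pair {u : Vec n} (hu : u ∈ Submodule.span ℝ {ℓ₁, ℓ₂})
    (h₁ : form u e₁ = 0) (h₂ : form u e₂ = 0) : u = 0 := by
  obtain ⟨x, y, rfl⟩ := Submodule.mem_span_pair.1 hu
  rw [smul_vec, smul_vec, vec_add, form_vec] at h₁ h₂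
  obtain rfl : x = 0 := by simpa using h₁
  obtain rfl : y = 0 := by simpa using h₂
  simp

theorem eq_one_of_mem_SN (ha : a ∈ SN n) (h₁ : (a : Mat n) *ᵥ e₁ = e₁)
    (h₂ : (a : Mat n) *ᵥ e₂ = e₂) : a = 1 := by
  have hfix (v : Vec n) (hv : (a : Mat n) *ᵥ v - v ∈ Submodule.span ℝ {ℓ₁, ℓ₂}) :
      (a : Mat n) *ᵥ v = v := by
    have hform (w : Vec n) (hw : (a : Mat n) *ᵥ w = w) : form ((a : Mat n) *ᵥ v - v) w = 0 := by
      rw [map_sub, _root_.sub_apply, sub_eq_zero, ← SN_le_isometryGroup ha v w, hw]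
    exact sub_eq_zero.1 (eq_zero_of_mem_span_null_pair hv (hform _ h₁) (hform _ h₂))
  have hℓ₂ : (a : Mat n) *ᵥ ℓ₂ = ℓ₂ := by
    obtain ⟨ρ, x, hx⟩ := exists_SN_mulVec_null_snd ha
    exact hfix _ (mem_span_null_pair (x := x) (y := Real.exp ρ - 1) (by rw [hx]; module))
  refine Units.ext (mat_ext_mulVec fun v => ?_)
  obtain ⟨x, y, z, w, f, rfl⟩ := exists_eq_vec v
  have hdecomp : (vec x y z w f : Vec n) =
      (x - z) • e₁ + z • ℓ₁ + (y - w) • e₂ + w • ℓ₂ + vec 0 0 0 0 f := by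
    simp [smul_vec, vec_add]
  rw [Units.val_one, one_mulVec, hdecomp]
  simp only [mulVec_add, mulVec_smul, h₁, h₂, hℓ₂, SN_mulVec_null_fst ha,
    hfix _ (SN_mulVec_last_sub_mem ha f)]

theorem eq_of_mem_SN (ha : a ∈ SN n) (hb : b ∈ SN n)
    (h₁ : (a : Mat n) *ᵥ e₁ = (b : Mat n) *ᵥ e₁) (h₂ : (a : Mat n) *ᵥ e₂ = (b : Mat n) *ᵥ e₂) :
    a = b := by
  refine (inv_mul_eq_one.1 (eq_one_of_mem_SN (mul_mem (inv_mem hb) ha) ?_ ?_)).symm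
  · rw [Units.val_mul, ← mulVec_mulVec, h₁, mulVec_mulVec, Units.inv_mul, one_mulVec]
  · rw [Units.val_mul, ← mulVec_mulVec, h₂, mulVec_mulVec, Units.inv_mul, one_mulVec]

end Group

/-! ### Global coordinates on `S_N` -/

section Param

variable {n : ℕ}

/-- Coordinates on `S_N`. The first factor holds the last `n` coordinates of a point of the
hyperboloid `⟨h, h⟩ = 1` in `ℝ^{1,n}`, the second one a vector of `ℝ^{1,n}`. -/
abbrev Param (n : ℕ) : Type := (ℝ × (Fin (n - 1) → ℝ)) × (ℝ × ℝ × (Fin (n - 1) → ℝ))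

/-- The positive first coordinate of the point of the hyperboloid with remaining coordinates
`t.1`. -/
def hyp (t : Param n) : ℝ := √(1 + t.1.1 ^ 2 + t.1.2 ⬝ᵥ t.1.2)

/-- The point of the hyperboloid with coordinates `t.1`. -/
def hyperboloidVec (t : Param n) : Vec n := vec 0 (hyp t) 0 t.1.1 t.1.2

/-- The vector with coordinates `t.2`, orthogonal to `e₁` and `e₃`. -/
def fiberVec (t : Param n) : Vec n := vec 0 t.2.1 0 t.2.2.1 t.2.2.2

/-- The image of `e₁` under the element of `S_N` with coordinates `t`. -/
def frame₁ (t : Param n) : Vec n := e₁ + fiberVec t - (form (fiberVec t) (fiberVec t) / 2) • ℓ₁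

/-- The image of `e₂` under the element of `S_N` with coordinates `t`. -/
def frame₂ (t : Param n) : Vec n :=
  hyperboloidVec t - form (fiberVec t) (hyperboloidVec t) • ℓ₁

/-- The element of `S_N` with coordinates `t`: a boost and a null rotation about `ℓ₂` move `e₂` to
the point of the hyperboloid, and a null rotation about `ℓ₁` then moves `e₁`. -/
def groupElement (t : Param n) : GL (Idx n) ℝ :=
  expGL (wedge (fiberVec t) ℓ₁) *
    expGL (wedge (vec 0 0 0 0 ((hyp t - t.1.1)⁻¹ • t.1.2)) ℓ₂) *
    expGL (Real.log (hyp t - t.1.1) • wedge e₂ e₄)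

theorem one_add_sq_add_dotProduct_pos (t : Param n) : 0 < 1 + t.1.1 ^ 2 + t.1.2 ⬝ᵥ t.1.2 := by
  have hdot : 0 ≤ t.1.2 ⬝ᵥ t.1.2 := dotProduct_self_star_nonneg t.1.2
  positivity

theorem hyp_sq (t : Param n) : hyp t ^ 2 = 1 + t.1.1 ^ 2 + t.1.2 ⬝ᵥ t.1.2 :=
  Real.sq_sqrt (one_add_sq_add_dotProduct_pos t).le

theorem lt_hyp (t : Param n) : t.1.1 < hyp t := by
  have hdot : 0 ≤ t.1.2 ⬝ᵥ t.1.2 := dotProduct_self_star_nonneg t.1.2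
  exact Real.lt_sqrt_of_sq_lt (by linarith)

theorem groupElement_mem_SN (t : Param n) : groupElement t ∈ SN n :=
  mul_mem (mul_mem (expGL_mem_connectedLieSubgroup (wedge_null_fst_mem_sN _ _ _))
    (expGL_mem_connectedLieSubgroup (wedge_null_snd_mem_sN _)))
    (expGL_mem_connectedLieSubgroup (Submodule.smul_mem _ _ wedge_e₂_e₄_mem_sN))

theorem exp_wedge_fiberVec_mulVec (t : Param n) (x : Vec n) :
    NormedSpace.exp (wedge (fiberVec t) ℓ₁) *ᵥ x = x + form ℓ₁ x • fiberVec t -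
      (form (fiberVec t) x + form ℓ₁ x * form (fiberVec t) (fiberVec t) / 2) • ℓ₁ :=
  exp_wedge_mulVec (by simp [form_vec]) (by simp [fiberVec, form_vec]) x

theorem exp_wedge_last_mulVec (g : Fin (n - 1) → ℝ) (x : Vec n) :
    NormedSpace.exp (wedge (vec 0 0 0 0 g) ℓ₂) *ᵥ x = x + form ℓ₂ x • vec 0 0 0 0 g -
      (form (vec 0 0 0 0 g) x - form ℓ₂ x * (g ⬝ᵥ g) / 2) • ℓ₂ := by
  rw [exp_wedge_mulVec (by simp [form_vec]) (by simp [form_vec]) x, form_vec 0 0 0 0 0 0 0 0]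
  congr 2
  ring

theorem exp_boost_mulVec {κ : ℝ} (hκ : 0 < κ) :
    NormedSpace.exp (Real.log κ • wedge (n := n) e₂ e₄) *ᵥ e₂ =
      vec 0 ((κ⁻¹ + κ) / 2) 0 ((κ⁻¹ - κ) / 2) 0 := by
  have hℓ₂ : NormedSpace.exp (Real.log κ • wedge (n := n) e₂ e₄) *ᵥ ℓ₂ = κ⁻¹ • ℓ₂ := by
    rw [exp_mulVec_of_eigenvector (ρ := -Real.log κ), Real.exp_neg, Real.exp_log hκ]
    simp only [smul_mulVec, wedge_mulVec, form_vec, smul_vec, vec_sub]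
    simp
  have hopp : NormedSpace.exp (Real.log κ • wedge (n := n) e₂ e₄) *ᵥ (e₂ - e₄) =
      κ • (e₂ - e₄) := by
    rw [exp_mulVec_of_eigenvector (ρ := Real.log κ), Real.exp_log hκ]
    simp only [smul_mulVec, wedge_mulVec, form_vec, smul_vec, vec_sub]
    simp
  have he₂ : (e₂ : Vec n) = (1 / 2 : ℝ) • ℓ₂ + (1 / 2 : ℝ) • (e₂ - e₄) := by
    rw [vec_sub, smul_vec, smul_vec, vec_add, vec_eq_vec_iff]
    norm_num
  nth_rw 2 [he₂]
  rw [mulVec_add, mulVec_smul, mulVec_smul, hℓ₂, hopp, vec_sub, smul_vec, smul_vec, smul_vec,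
    smul_vec, vec_add, vec_eq_vec_iff]
  exact ⟨by ring, by ring, by ring, by ring, by simp⟩

theorem groupElement_mulVec_e₁ (t : Param n) : (groupElement t : Mat n) *ᵥ e₁ = frame₁ t := by
  have hboost : NormedSpace.exp (Real.log (hyp t - t.1.1) • wedge (n := n) e₂ e₄) *ᵥ e₁ = e₁ := by
    simpa using exp_mulVec_of_eigenvector (ρ := 0)
      (by simp [smul_mulVec, wedge_mulVec, form_vec])
  rw [groupElement, Units.val_mul, Units.val_mul, ← mulVec_mulVec, ← mulVec_mulVec, coe_expGL,
    coe_expGL, coe_expGL, hboost, exp_wedge_last_mulVec, exp_wedge_fiberVec_mulVec, frame₁]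
  simp [form_vec, fiberVec]

theorem exp_mul_exp_boost_mulVec_e₂ (t : Param n) :
    NormedSpace.exp (wedge (vec 0 0 0 0 ((hyp t - t.1.1)⁻¹ • t.1.2)) ℓ₂) *ᵥ
      (NormedSpace.exp (Real.log (hyp t - t.1.1) • wedge e₂ e₄) *ᵥ e₂) = hyperboloidVec t := by
  obtain ⟨κ, hκ_def⟩ : ∃ κ, hyp t - t.1.1 = κ := ⟨_, rfl⟩
  have hκ : 0 < κ := hκ_def ▸ sub_pos.2 (lt_hyp t)
  have hcancel : κ⁻¹ * κ = 1 := inv_mul_cancel₀ hκ.ne'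
  have hinv : κ⁻¹ * (1 + t.1.2 ⬝ᵥ t.1.2) = hyp t + t.1.1 := by
    rw [inv_mul_eq_iff_eq_mul₀ hκ.ne', ← hκ_def]
    linear_combination -hyp_sq t
  have hform : form (n := n) ℓ₂ (vec 0 ((κ⁻¹ + κ) / 2) 0 ((κ⁻¹ - κ) / 2) 0) = κ := by
    rw [form_vec, dotProduct_zero]
    ring
  have hform_last : form (vec 0 0 0 0 (κ⁻¹ • t.1.2))
      (vec 0 ((κ⁻¹ + κ) / 2) 0 ((κ⁻¹ - κ) / 2) 0) = 0 := by
    simp [form_vec]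
  rw [hκ_def, exp_boost_mulVec hκ, exp_wedge_last_mulVec, hform, hform_last, hyperboloidVec,
    smul_vec, smul_vec, vec_add, vec_sub, vec_eq_vec_iff, smul_dotProduct, dotProduct_smul,
    smul_eq_mul, smul_eq_mul]
  refine ⟨by ring, ?_, by ring, ?_, ?_⟩
  · linear_combination (1 / 2) * hinv + (κ⁻¹ * (t.1.2 ⬝ᵥ t.1.2) / 2) * hcancel - hκ_def / 2
  · linear_combination (1 / 2) * hinv + (κ⁻¹ * (t.1.2 ⬝ᵥ t.1.2) / 2) * hcancel + hκ_def / 2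
  · simp [smul_smul, mul_inv_cancel₀ hκ.ne']

theorem groupElement_mulVec_e₂ (t : Param n) : (groupElement t : Mat n) *ᵥ e₂ = frame₂ t := by
  rw [groupElement, Units.val_mul, Units.val_mul, ← mulVec_mulVec, ← mulVec_mulVec, coe_expGL,
    coe_expGL, coe_expGL, exp_mul_exp_boost_mulVec_e₂, exp_wedge_fiberVec_mulVec, frame₂]
  simp [form_vec, hyperboloidVec]

theorem exists_frame_eq {x z : Vec n} (hxx : form x x = 1) (hzz : form z z = 1)
    (hxz : form x z = 0) (hxℓ : form x ℓ₁ = 1) (hzℓ : form z ℓ₁ = 0) (hpos : 0 < form z ℓ₂) :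
    ∃ t : Param n, frame₁ t = x ∧ frame₂ t = z := by
  obtain ⟨x₁, x₂, x₃, x₄, k, rfl⟩ := exists_eq_vec x
  obtain ⟨z₁, z₂, z₃, z₄, f, rfl⟩ := exists_eq_vec z
  simp only [form_vec, dotProduct_zero] at hxx hzz hxz hxℓ hzℓ hpos
  obtain rfl : z₁ = z₃ := by linarith
  obtain rfl : x₁ = 1 + x₃ := by linarith
  have hff : 0 ≤ f ⬝ᵥ f := dotProduct_self_star_nonneg f
  have hsum : 0 < z₂ + z₄ := by
    have hprod : 0 < (z₂ - z₄) * (z₂ + z₄) := by linarith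
    exact pos_of_mul_pos_right hprod (by linarith)
  have hhyp : hyp (((z₄, f), (x₂, x₄, k)) : Param n) = z₂ := by
    rw [hyp, Real.sqrt_eq_iff_mul_self_eq_of_pos (by linarith)]
    linarith
  refine ⟨((z₄, f), (x₂, x₄, k)), ?_, ?_⟩
  · rw [frame₁, fiberVec, form_vec, smul_vec, vec_add, vec_sub, vec_eq_vec_iff]
    exact ⟨by linarith, by ring, by linarith, by ring, by simp⟩
  · rw [frame₂, fiberVec, hyperboloidVec, hhyp, form_vec, smul_vec, vec_sub, vec_eq_vec_iff]
    exact ⟨by linarith, by ring, by linarith, by ring, by simp⟩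

theorem exists_frame_eq_of_mem_SN {a : GL (Idx n) ℝ} (ha : a ∈ SN n) :
    ∃ t : Param n, frame₁ t = (a : Mat n) *ᵥ e₁ ∧ frame₂ t = (a : Mat n) *ᵥ e₂ := by
  have hisom := SN_le_isometryGroup ha
  have hnull (x : Vec n) : form ((a : Mat n) *ᵥ x) ℓ₁ = form x ℓ₁ := by
    rw [← hisom x, SN_mulVec_null_fst ha]
  obtain ⟨ρ, x, hx⟩ := exists_SN_mulVec_null_snd ha
  have hscale : Real.exp ρ * form ((a : Mat n) *ᵥ e₂) ℓ₂ = 1 := by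
    have h := hisom e₂ ℓ₂
    rw [hx, map_add, map_smul, map_smul, hnull, form_vec, form_vec] at h
    simpa using h
  have hpos : 0 < form ((a : Mat n) *ᵥ e₂) ℓ₂ :=
    pos_of_mul_pos_right (one_pos.trans_eq hscale.symm) (Real.exp_pos ρ).le
  refine exists_frame_eq ?_ ?_ ?_ ?_ ?_ hpos
  · simp [hisom _ _, form_vec]
  · simp [hisom _ _, form_vec]
  · simp [hisom _ _, form_vec]
  · simp [hnull, form_vec]
  · simp [hnull, form_vec]

theorem contDiff_hyp {k : WithTop ℕ∞} : ContDiff ℝ k (hyp : Param n → ℝ) := by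
  refine ContDiff.sqrt ?_ fun t => (one_add_sq_add_dotProduct_pos t).ne'
  unfold dotProduct
  fun_prop

theorem contDiff_hyperboloidVec {k : WithTop ℕ∞} :
    ContDiff ℝ k (hyperboloidVec : Param n → Vec n) :=
  contDiff_vec contDiff_const contDiff_hyp contDiff_const (by fun_prop) (by fun_prop)

theorem contDiff_fiberVec {k : WithTop ℕ∞} : ContDiff ℝ k (fiberVec : Param n → Vec n) :=
  contDiff_vec contDiff_const (by fun_prop) contDiff_const (by fun_prop) (by fun_prop)

theorem contDiff_frame₁ {k : WithTop ℕ∞} : ContDiff ℝ k (frame₁ : Param n → Vec n) :=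
  (contDiff_const.add contDiff_fiberVec).sub
    (((contDiff_form contDiff_fiberVec contDiff_fiberVec).div_const 2).smul contDiff_const)

theorem contDiff_frame₂ {k : WithTop ℕ∞} : ContDiff ℝ k (frame₂ : Param n → Vec n) :=
  contDiff_hyperboloidVec.sub
    ((contDiff_form contDiff_fiberVec contDiff_hyperboloidVec).smul contDiff_const)

theorem isAdaptedFrame_frame : IsAdaptedFrame ℓ₁ (frame₁ : Param n → Vec n) frame₂ where
  form_null_null := by simp [form_vec]
  contDiff_fst := contDiff_frame₁
  contDiff_snd := contDiff_frame₂
  isPositiveFrame t := by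
    rw [← groupElement_mulVec_e₁, ← groupElement_mulVec_e₂]
    exact isPositiveFrame_of_mem_isometryGroup (SN_le_isometryGroup (groupElement_mem_SN t))
  form_fst_null t := by simp [frame₁, fiberVec, form_vec]
  form_snd_null t := by simp [frame₂, hyperboloidVec, form_vec]

theorem continuous_groupElement : Continuous (groupElement : Param n → GL (Idx n) ℝ) := by
  have hne (t : Param n) : hyp t - t.1.1 ≠ 0 := (sub_pos.2 (lt_hyp t)).ne'
  have hκ : Continuous fun t : Param n => hyp t - t.1.1 :=
    (contDiff_hyp (k := 0)).continuous.sub (by fun_prop)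
  have hlast : Continuous fun t : Param n =>
      (vec 0 0 0 0 ((hyp t - t.1.1)⁻¹ • t.1.2) : Vec n) := by
    have hsmul : Continuous fun t : Param n => (hyp t - t.1.1)⁻¹ • t.1.2 :=
      (hκ.inv₀ hne).smul (by fun_prop)
    exact (contDiff_zero.1 (contDiff_vec contDiff_const contDiff_const contDiff_const
      contDiff_const contDiff_id)).comp hsmul
  have hfiber : Continuous (fiberVec : Param n → Vec n) := (contDiff_fiberVec (k := 0)).continuous
  exact ((continuous_expGL.comp (by fun_prop)).mul (continuous_expGL.comp (by fun_prop))).mul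
    (continuous_expGL.comp ((hκ.log hne).smul continuous_const))

end Param

/-! ### The orbit `S_N.o` -/

section Orbit

variable {n : ℕ}

/-- The point of the orbit with coordinates `t`. -/
def point (t : Param n) : Mat n := wedge (frame₁ t) (frame₂ t)

/-- The unit normal vector of the orbit at the point with coordinates `t`. -/
def normalAt (t : Param n) : Mat n := adaptedNormal ℓ₁ (frame₁ t) (frame₂ t)

/-- The coordinates of a point `p` of the orbit, read off from the adapted frame `-p (p ℓ₁)`,
`-p ℓ₁` of its plane. -/
def coords (p : Mat n) : Param n :=
  ((-(p *ᵥ ℓ₁) (.inr (.inl 1)), fun i => -(p *ᵥ ℓ₁) (.inr (.inr i))),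
    (-(p *ᵥ (p *ᵥ ℓ₁)) (.inl 1), -(p *ᵥ (p *ᵥ ℓ₁)) (.inr (.inl 1)),
      fun i => -(p *ᵥ (p *ᵥ ℓ₁)) (.inr (.inr i))))

theorem contDiff_coords {k : WithTop ℕ∞} : ContDiff ℝ k (coords : Mat n → Param n) := by
  have hfst : ContDiff ℝ k fun p : Mat n => p *ᵥ ℓ₁ := contDiff_mulVec contDiff_id contDiff_const
  have hsnd : ContDiff ℝ k fun p : Mat n => p *ᵥ (p *ᵥ ℓ₁) := contDiff_mulVec contDiff_id hfst
  rw [contDiff_pi] at hfst hsnd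
  unfold coords
  fun_prop

theorem contDiff_point : ContDiff ℝ ∞ (point : Param n → Mat n) :=
  isAdaptedFrame_frame.contDiff_wedge

theorem coords_point (t : Param n) : coords (point t) = t := by
  rw [coords, point, isAdaptedFrame_frame.wedge_mulVec_wedge_mulVec_null,
    isAdaptedFrame_frame.wedge_mulVec_null]
  simp [frame₁, frame₂, fiberVec, hyperboloidVec, vec]

theorem Ad_Z {a : GL (Idx n) ℝ} (ha : a ∈ isometryGroup n) :
    Ad a (Z n) = wedge ((a : Mat n) *ᵥ e₁) ((a : Mat n) *ᵥ e₂) := by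
  rw [Z_eq_wedge, Ad_wedge ha]

theorem Ad_groupElement_Z (t : Param n) : Ad (groupElement t) (Z n) = point t := by
  rw [Ad_Z (SN_le_isometryGroup (groupElement_mem_SN t)), groupElement_mulVec_e₁,
    groupElement_mulVec_e₂, point]

theorem point_mem_orbitSN (t : Param n) : point t ∈ orbitSN n :=
  ⟨groupElement t, groupElement_mem_SN t, (Ad_groupElement_Z t).symm⟩

theorem point_mem_grassmannian (t : Param n) : point t ∈ grassmannian n :=
  ⟨groupElement t, SN_le_SO₀ (groupElement_mem_SN t), (Ad_groupElement_Z t).symm⟩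

theorem frame_coords_Ad_Z {a : GL (Idx n) ℝ} (ha : a ∈ SN n) :
    frame₁ (coords (Ad a (Z n))) = (a : Mat n) *ᵥ e₁ ∧
      frame₂ (coords (Ad a (Z n))) = (a : Mat n) *ᵥ e₂ := by
  obtain ⟨t, h₁, h₂⟩ := exists_frame_eq_of_mem_SN ha
  rw [Ad_Z (SN_le_isometryGroup ha), ← h₁, ← h₂, ← point, coords_point]
  exact ⟨rfl, rfl⟩

theorem point_coords {p : Mat n} (hp : p ∈ orbitSN n) : point (coords p) = p := by
  obtain ⟨a, ha, rfl⟩ := hp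
  obtain ⟨h₁, h₂⟩ := frame_coords_Ad_Z ha
  rw [point, h₁, h₂, Ad_Z (SN_le_isometryGroup ha)]

theorem groupElement_coords_Ad_Z {a : GL (Idx n) ℝ} (ha : a ∈ SN n) :
    groupElement (coords (Ad a (Z n))) = a := by
  obtain ⟨h₁, h₂⟩ := frame_coords_Ad_Z ha
  exact eq_of_mem_SN (groupElement_mem_SN _) ha ((groupElement_mulVec_e₁ _).trans h₁)
    ((groupElement_mulVec_e₂ _).trans h₂)

theorem normalAt_coords_Ad_Z {a : GL (Idx n) ℝ} (ha : a ∈ SN n) :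
    normalAt (coords (Ad a (Z n))) = Ad a (velocity (N n) (Z n)) := by
  obtain ⟨h₁, h₂⟩ := frame_coords_Ad_Z ha
  have he₃ : (e₃ : Vec n) = ℓ₁ - e₁ := by simp [vec_sub]
  have hsmul : Ad a ((2 : ℝ) • wedge e₂ e₃) = (2 : ℝ) • Ad a (wedge e₂ e₃) := by simp [Ad]
  rw [velocity_N_Z, hsmul, Ad_wedge (SN_le_isometryGroup ha), he₃, mulVec_sub,
    SN_mulVec_null_fst ha, normalAt, h₁, h₂, adaptedNormal, planeVelocity, wedge_swap]
  simp only [map_sub, map_smul, map_zero]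
  module

/-- The global coordinates of the orbit. -/
def orbitHomeomorph (n : ℕ) : orbitSN n ≃ₜ Param n where
  toFun p := coords p.1
  invFun t := ⟨point t, point_mem_orbitSN t⟩
  left_inv p := Subtype.ext (point_coords p.2)
  right_inv t := coords_point t
  continuous_toFun := (contDiff_coords (k := 0)).continuous.comp continuous_subtype_val
  continuous_invFun := contDiff_point.continuous.subtype_mk _

/-- The orbit map of `S_N` as a homeomorphism onto the orbit. -/
def orbitMapHomeomorph (n : ℕ) : SN n ≃ₜ orbitSN n where
  toFun a := ⟨Ad a.1 (Z n), a.1, a.2, rfl⟩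
  invFun p := ⟨groupElement (coords p.1), groupElement_mem_SN _⟩
  left_inv a := Subtype.ext (groupElement_coords_Ad_Z a.2)
  right_inv p := Subtype.ext ((Ad_groupElement_Z _).trans (point_coords p.2))
  continuous_toFun :=
    (((Units.continuous_val.comp continuous_subtype_val).mul continuous_const).mul
      (Units.continuous_val.comp continuous_subtype_val.inv)).subtype_mk _
  continuous_invFun := (continuous_groupElement.comp
    ((contDiff_coords (k := 0)).continuous.comp continuous_subtype_val)).subtype_mk _

theorem isEmbedding_orbitMap (n : ℕ) : Topology.IsEmbedding fun a : SN n => Ad a.1 (Z n) :=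
  Topology.IsEmbedding.subtypeVal.comp (orbitMapHomeomorph n).isEmbedding

variable {E : Type*} [NormedAddCommGroup E] [NormedSpace ℝ E] (c : E ≃L[ℝ] Param n)

/-- The global coordinates of the orbit in a model space `E`. -/
def orbitChart : orbitSN n ≃ₜ E := (orbitHomeomorph n).trans c.symm.toHomeomorph

theorem orbitChart_apply (p : orbitSN n) : c (orbitChart c p) = coords p.1 :=
  c.apply_symm_apply (coords p.1)

theorem point_comp_orbitChart : (point ∘ c) ∘ orbitChart c = Subtype.val :=
  funext fun p => (congrArg point (orbitChart_apply c p)).trans (point_coords p.2)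

theorem isHypersurfaceParametrization_point_comp [FiniteDimensional ℝ E] :
    IsHypersurfaceParametrization (point ∘ c) (normalAt ∘ c) (c.symm ∘ coords) :=
  (isAdaptedFrame_frame.comp c.contDiff).isHypersurfaceParametrization
    (by
      simp only [c.toLinearEquiv.finrank_eq, Module.finrank_prod, Module.finrank_self,
        Module.finrank_fintype_fun_eq_card, Fintype.card_fin]
      omega)
    (fun t => point_mem_grassmannian (c t)) (c.symm.contDiff.comp contDiff_coords)
    fun t => (congrArg c.symm (coords_point (c t))).trans (c.symm_apply_apply t)

theorem normalAt_comp_orbitChart_eq {p : orbitSN n} {a : GL (Idx n) ℝ} (ha : a ∈ SN n)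
    (hp : p.1 = Ad a (Z n)) :
    ((normalAt ∘ c) ∘ orbitChart c) p = Ad a (velocity (N n) (Z n)) := by
  rw [Function.comp_apply, Function.comp_apply, orbitChart_apply, hp, normalAt_coords_Ad_Z ha]

theorem isContactMetric_orbit [FiniteDimensional ℝ E] [ChartedSpace E (orbitSN n)]
    [IsManifold 𝓘(ℝ, E) ∞ (orbitSN n)] (he : IsGlobalChart (orbitChart c)) :
    ((isHypersurfaceParametrization_point_comp c).almostContactMetricStructure
      he).IsContactMetric :=
  (isHypersurfaceParametrization_point_comp c).isContactMetric he
    (isAdaptedFrame_frame.comp c.contDiff).metric_fderiv_wedge_J_eq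

end Orbit

end LieHypersurface

end

/-- Let `n ≥ 2`. The orbit map `a ↦ a.o` identifies the group `S_N` with the orbit `S_N.o`. The orbit
is an embedded real hypersurface of `G₂*(ℝ^{n+3})`, of dimension `2 n + 1`, with the `S_N`-invariant
unit normal field `ν` whose value at `a.o` is the translate by `a` of the value `d/dt exp(tN).o` at
`o`, and with the structure induced from the Grassmannian it is a contact metric manifold. -/
theorem mainTheorem6 (n : ℕ) (hn : 2 ≤ n) :
    Topology.IsEmbedding
        (fun a : LieHypersurface.SN n => LieHypersurface.Ad a.1 (LieHypersurface.Z n)) ∧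
    ∃ (_ : ChartedSpace (EuclideanSpace ℝ (Fin (2 * n + 1))) (LieHypersurface.orbitSN n))
      (_ : IsManifold 𝓘(ℝ, EuclideanSpace ℝ (Fin (2 * n + 1))) ∞ (LieHypersurface.orbitSN n))
      (ν : LieHypersurface.orbitSN n → LieHypersurface.Mat n)
      (s : LieHypersurface.AlmostContactMetricStructure
        𝓘(ℝ, EuclideanSpace ℝ (Fin (2 * n + 1))) (LieHypersurface.orbitSN n)),
      (∀ (x : LieHypersurface.orbitSN n), ∀ a ∈ LieHypersurface.SN n,
        x.1 = LieHypersurface.Ad a (LieHypersurface.Z n) →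
        ν x = LieHypersurface.Ad a
          (LieHypersurface.velocity (LieHypersurface.N n) (LieHypersurface.Z n))) ∧
      LieHypersurface.IsHypersurfaceWithUnitNormal
        𝓘(ℝ, EuclideanSpace ℝ (Fin (2 * n + 1))) (Subtype.val : LieHypersurface.orbitSN n → _) ν ∧
      LieHypersurface.IsInducedStructure
        𝓘(ℝ, EuclideanSpace ℝ (Fin (2 * n + 1))) (Subtype.val : LieHypersurface.orbitSN n → _) ν s ∧
      s.IsContactMetric := by
  have hdim : Module.finrank ℝ (EuclideanSpace ℝ (Fin (2 * n + 1))) =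
      Module.finrank ℝ (LieHypersurface.Param n) := by
    simp only [finrank_euclideanSpace, Fintype.card_fin, Module.finrank_prod, Module.finrank_self,
      Module.finrank_fintype_fun_eq_card]
    omega
  let c := ContinuousLinearEquiv.ofFinrankEq hdim
  let e := (LieHypersurface.orbitChart c).toOpenPartialHomeomorph
  let _ : ChartedSpace (EuclideanSpace ℝ (Fin (2 * n + 1))) (LieHypersurface.orbitSN n) :=
    e.singletonChartedSpace rfl
  have hmanifold : IsManifold 𝓘(ℝ, EuclideanSpace ℝ (Fin (2 * n + 1))) ∞
      (LieHypersurface.orbitSN n) := e.isManifold_singleton rfl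
  have he : LieHypersurface.IsGlobalChart (LieHypersurface.orbitChart c) :=
    fun _ => e.singletonChartedSpace_chartAt_eq rfl
  have hparam := LieHypersurface.isHypersurfaceParametrization_point_comp c
  have hval := LieHypersurface.point_comp_orbitChart c
  exact ⟨LieHypersurface.isEmbedding_orbitMap n, inferInstance, hmanifold, _,
    hparam.almostContactMetricStructure he,
    fun _ _ ha hx => LieHypersurface.normalAt_comp_orbitChart_eq c ha hx,
    hval ▸ hparam.isHypersurfaceWithUnitNormal he, hval ▸ hparam.isInducedStructure he,
    LieHypersurface.isContactMetric_orbit c he⟩
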